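/- Let $n,m\ge 0$ be integers, let $2\le k\le\infty$, let $f:\mathbb R^n\to\mathbb R$ be twice differentiable and let $c_1,\dots,c_m:\mathbb R^n\to\mathbb R$ be of class $C^k$. Put $\Omega=\{x\in\mathbb R^n : c_i(x)=0,\ i=1,\dots,m\}$ and assume that the linear independence constraint qualification (LICQ) holds on $\Omega$: for every $x\in\Omega$ the gradients $\nabla c_1(x),\dots,\nabla c_m(x)$ are linearly independent. Let $\mathcal L(x,\lambda)=f(x)-\sum_{i=1}^m\lambda_i c_i(x)$, let $\mathcal T_\Omega(x)=\operatorname{span}\{\nabla c_1(x),\dots,\nabla c_m(x)\}^\perp$, and let $P_x$ be the orthogonal projection of $\mathbb R^n$ onto $\mathcal T_\Omega(x)$. Then: 1. For every $x\in\Omega$ the problem $\min_\lambda\|\nabla_x\mathcal L(x,\lambda)\|$ has exactly one solution $\lambda^\star(x)\in\mathbb R^m$. Put $\mathcal G(x)=\nabla_x\mathcal L(x,\lambda^\star(x))$ and $\mathcal H(x)=P_x^\top\,\nabla^2_{xx}\mathcal L(x,\lambda^\star(x))\,P_x$, where $\nabla_{xx}^2$ is taken with $\lambda$ held fixed. 2.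 $\Omega$, with the subspace topology and the metric induced from $\mathbb R^n$, is a $C^k$ embedded Riemannian submanifold of $\mathbb R^n$ of dimension $n-m$ (unless it is empty), and its tangent space at $x$, regarded as a subspace of $\mathbb R^n$, is $\mathcal T_\Omega(x)$. 3. For every $x\in\Omega$, $\mathcal G(x)$ is the Riemannian gradient at $x$ of $f|_\Omega$: $\operatorname{grad} f(x)=\mathcal G(x)$. 4. $\Omega$ has a Riemannian (Levi-Civita, i.e. metric and torsion-free) connection $\overline\nabla$, and for every $x\in\Omega$ and all $\xi,\eta\in\mathcal T_\Omega(x)$ the Riemannian Hessian of $f|_\Omega$ satisfies $$\operatorname{Hess} f(x)[\xi,\eta]=\langle\overline\nabla_\xi\operatorname{grad} f(x),\eta\rangle=\langle\mathcal H(x)\xi,\eta\rangle .$$ -/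

import Mathlib

open scoped Manifold ContDiff Bundle RealInnerProductSpace

noncomputable section

/-! ### Riemannian gradient, Levi-Civita connection and Riemannian Hessian -/

section Riemannian

variable {E : Type*} [NormedAddCommGroup E] [NormedSpace ℝ E]
  {H : Type*} [TopologicalSpace H] (I : ModelWithCorners ℝ E H)
  {M : Type*} [TopologicalSpace M] [ChartedSpace H M]
  [Bundle.RiemannianBundle (fun x : M ↦ TangentSpace I x)]

/-- The Riemannian gradient of `f : M → ℝ`: the vector field `grad f` representing the
differential, `⟪grad f x, v⟫ = df_x(v)` (see `inner_riemannianGradient`). -/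
def riemannianGradient [FiniteDimensional ℝ E] (f : M → ℝ) (x : M) : TangentSpace I x :=
  haveI : FiniteDimensional ℝ (TangentSpace I x) := inferInstanceAs (FiniteDimensional ℝ E)
  haveI : CompleteSpace (TangentSpace I x) := FiniteDimensional.complete ℝ _
  (InnerProductSpace.toDual ℝ (TangentSpace I x)).symm (d% f x)

theorem inner_riemannianGradient [FiniteDimensional ℝ E] (f : M → ℝ) (x : M)
    (v : TangentSpace I x) : inner ℝ (riemannianGradient I f x) v = d% f x v := by
  have : FiniteDimensional ℝ (TangentSpace I x) := inferInstanceAs (FiniteDimensional ℝ E)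
  have : CompleteSpace (TangentSpace I x) := FiniteDimensional.complete ℝ _
  exact InnerProductSpace.toDual_symm_apply

variable {I} [IsManifold I 1 M]

/-- `∇` (with `cov Y x (X x) = (∇_X Y) x`) is the Riemannian (Levi-Civita) connection: it is
compatible with the metric, `X⟪Y, Z⟫ = ⟪∇_X Y, Z⟫ + ⟪Y, ∇_X Z⟫`, and torsion-free,
`∇_X Y - ∇_Y X = [X, Y]`. -/
structure IsLeviCivita (cov : CovariantDerivative I E (fun x : M ↦ TangentSpace I x)) : Prop where
  metric : ∀ {x : M} {X Y Z : Π x : M, TangentSpace I x},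
    MDiffAt (T% X) x → MDiffAt (T% Y) x → MDiffAt (T% Z) x →
      d% (fun y ↦ inner ℝ (Y y) (Z y)) x (X x) =
        inner ℝ (cov Y x (X x)) (Z x) + inner ℝ (Y x) (cov Z x (X x))
  torsion_free : ∀ {X Y : Π x : M, TangentSpace I x} {x : M},
    MDiffAt (T% X) x → MDiffAt (T% Y) x →
      cov Y x (X x) - cov X x (Y x) = VectorField.mlieBracket I X Y x

/-- On a `C²` manifold with a `C¹` metric, this is metric compatibility together with the
vanishing of the torsion tensor. -/
theorem isLeviCivita_iff {N : Type*} [TopologicalSpace N] [ChartedSpace H N]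
    [IsManifold I 2 N] [FiniteDimensional ℝ E] [ContMDiffVectorBundle 1 E (TangentSpace I (M := N)) I]
    [Bundle.RiemannianBundle (fun x : N ↦ TangentSpace I x)]
    [IsContMDiffRiemannianBundle I 1 E (fun x : N ↦ TangentSpace I x)] [CompleteSpace E]
    (cov : CovariantDerivative I E (fun x : N ↦ TangentSpace I x)) :
    IsLeviCivita cov ↔
      CovariantDerivative.IsMetricCompatible (V := fun x : N ↦ TangentSpace I x) cov ∧
      cov.torsion = 0 := by
  rw [CovariantDerivative.isMetricCompatible_iff, CovariantDerivative.torsion_eq_zero_iff]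
  exact ⟨fun h ↦ ⟨h.metric, h.torsion_free⟩, fun h ↦ ⟨h.1, h.2⟩⟩

/-- The Riemannian Hessian `Hess f (x)[ξ, η] = ⟪∇_ξ grad f, η⟫` for the connection `∇`. -/
def riemannianHessian [FiniteDimensional ℝ E]
    (cov : CovariantDerivative I E (fun x : M ↦ TangentSpace I x))
    (f : M → ℝ) (x : M) (ξ η : TangentSpace I x) : ℝ :=
  inner ℝ (cov (riemannianGradient I f) x ξ) η

end Riemannian

/-! ### Embedded Riemannian submanifolds of a Euclidean space -/

section Submanifold

variable {V : Type*} [NormedAddCommGroup V] [InnerProductSpace ℝ V]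
  (E : Type*) [NormedAddCommGroup E] [NormedSpace ℝ E]

variable {E} in
/-- The differential at `x` of the inclusion `S → V`, as a map `T_x S → V`. -/
def inclusionDeriv {S : Set V} [ChartedSpace E S] (x : S) : TangentSpace 𝓘(ℝ, E) x →L[ℝ] V :=
  mvfderiv 𝓘(ℝ, E) (Subtype.val : S → V) x

/-- A subset `S` of the Euclidean space `V`, with the subspace topology, an atlas modelled on `E`
and a metric on its tangent spaces, is a `C^k` embedded Riemannian submanifold of `V`: the
inclusion is a `C^k` embedding (immersion and homeomorphism onto its image), and the metric is the
(`C^(k-1)`) metric induced from `V` by the inclusion. -/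
structure IsEmbeddedRiemannianSubmanifold (k : ℕ∞) (S : Set V) [ChartedSpace E S]
    [IsManifold 𝓘(ℝ, E) 1 S] [Bundle.RiemannianBundle (fun x : S ↦ TangentSpace 𝓘(ℝ, E) x)] :
    Prop where
  isManifold : IsManifold 𝓘(ℝ, E) k S
  isSmoothEmbedding : Manifold.IsSmoothEmbedding 𝓘(ℝ, E) 𝓘(ℝ, V) k (Subtype.val : S → V)
  contMDiff_metric :
    IsContMDiffRiemannianBundle 𝓘(ℝ, E) ((k - 1 : ℕ∞) : ℕ∞ω) E
      (fun x : S ↦ TangentSpace 𝓘(ℝ, E) x)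
  inner_eq : ∀ (x : S) (u v : TangentSpace 𝓘(ℝ, E) x),
    inner ℝ u v = ⟪inclusionDeriv x u, inclusionDeriv x v⟫

end Submanifold

/-! ### The equality constrained problem -/

section Problem

variable {n m : ℕ}

/-- The feasible set `Ω = {x | c i x = 0 for all i}`. -/
def feasibleSet (c : Fin m → EuclideanSpace ℝ (Fin n) → ℝ) : Set (EuclideanSpace ℝ (Fin n)) :=
  {x | ∀ i, c i x = 0}

/-- LICQ at `x`: the constraint gradients at `x` are linearly independent. -/
def LICQAt (c : Fin m → EuclideanSpace ℝ (Fin n) → ℝ) (x : EuclideanSpace ℝ (Fin n)) : Prop :=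
  LinearIndependent ℝ (fun i ↦ gradient (c i) x)

/-- The normal subspace at `x`: the span of the constraint gradients. -/
def normalSubspace (c : Fin m → EuclideanSpace ℝ (Fin n) → ℝ) (x : EuclideanSpace ℝ (Fin n)) :
    Submodule ℝ (EuclideanSpace ℝ (Fin n)) :=
  Submodule.span ℝ (Set.range fun i ↦ gradient (c i) x)

/-- The tangent subspace at `x`: the orthogonal complement of the normal subspace. -/
def tangentSubspace (c : Fin m → EuclideanSpace ℝ (Fin n) → ℝ) (x : EuclideanSpace ℝ (Fin n)) :
    Submodule ℝ (EuclideanSpace ℝ (Fin n)) :=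
  (normalSubspace c x)ᗮ

/-- The orthogonal projection `P_x` of `ℝⁿ` onto the tangent subspace. -/
def tangentProjection (c : Fin m → EuclideanSpace ℝ (Fin n) → ℝ) (x : EuclideanSpace ℝ (Fin n)) :
    EuclideanSpace ℝ (Fin n) →L[ℝ] EuclideanSpace ℝ (Fin n) :=
  (tangentSubspace c x).starProjection

/-- The Lagrangian `L(x, μ) = f x - ∑ i, μ i * c i x`. -/
def lagrangian (f : EuclideanSpace ℝ (Fin n) → ℝ) (c : Fin m → EuclideanSpace ℝ (Fin n) → ℝ)
    (x : EuclideanSpace ℝ (Fin n)) (μ : EuclideanSpace ℝ (Fin m)) : ℝ :=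
  f x - ∑ i, μ i * c i x

/-- `∇ₓ L(x, μ)`. -/
def gradLagrangian (f : EuclideanSpace ℝ (Fin n) → ℝ)
    (c : Fin m → EuclideanSpace ℝ (Fin n) → ℝ)
    (x : EuclideanSpace ℝ (Fin n)) (μ : EuclideanSpace ℝ (Fin m)) : EuclideanSpace ℝ (Fin n) :=
  gradient (fun y ↦ lagrangian f c y μ) x

/-- `∇²ₓₓ L(x, μ)`, the derivative in `x`, with `μ` fixed, of `∇ₓ L(x, μ)`. -/
def hessLagrangian (f : EuclideanSpace ℝ (Fin n) → ℝ)
    (c : Fin m → EuclideanSpace ℝ (Fin n) → ℝ)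
    (x : EuclideanSpace ℝ (Fin n)) (μ : EuclideanSpace ℝ (Fin m)) :
    EuclideanSpace ℝ (Fin n) →L[ℝ] EuclideanSpace ℝ (Fin n) :=
  fderiv ℝ (fun y ↦ gradLagrangian f c y μ) x

/-- `μ ∈ argmin_ν ‖∇ₓ L(x, ν)‖`. -/
def IsMultiplier (f : EuclideanSpace ℝ (Fin n) → ℝ)
    (c : Fin m → EuclideanSpace ℝ (Fin n) → ℝ)
    (x : EuclideanSpace ℝ (Fin n)) (μ : EuclideanSpace ℝ (Fin m)) : Prop :=
  IsMinOn (fun ν ↦ ‖gradLagrangian f c x ν‖) Set.univ μ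

/-- The generalized gradient `G(x) = ∇ₓ L(x, μ x)` for the choice `μ` of multipliers. -/
def generalizedGradient (f : EuclideanSpace ℝ (Fin n) → ℝ)
    (c : Fin m → EuclideanSpace ℝ (Fin n) → ℝ)
    (μ : EuclideanSpace ℝ (Fin n) → EuclideanSpace ℝ (Fin m)) (x : EuclideanSpace ℝ (Fin n)) :
    EuclideanSpace ℝ (Fin n) :=
  gradLagrangian f c x (μ x)

/-- The generalized Hessian `H(x) = P_xᵀ ∇²ₓₓ L(x, μ x) P_x` for the choice `μ` of multipliers. -/
def generalizedHessian (f : EuclideanSpace ℝ (Fin n) → ℝ)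
    (c : Fin m → EuclideanSpace ℝ (Fin n) → ℝ)
    (μ : EuclideanSpace ℝ (Fin n) → EuclideanSpace ℝ (Fin m)) (x : EuclideanSpace ℝ (Fin n)) :
    EuclideanSpace ℝ (Fin n) →L[ℝ] EuclideanSpace ℝ (Fin n) :=
  (tangentProjection c x).adjoint ∘L hessLagrangian f c x (μ x) ∘L tangentProjection c x

end Problem

end

/-!
*The manifold.* By LICQ the map `C = (c₁, …, cₘ)` has a surjective derivative `A` at every `x ∈ Ω`.
Completing `A` to a linear isomorphism `T : ℝⁿ ≃ ℝⁿ⁻ᵐ × ℝᵐ` with second component `A`, the map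
`y ↦ ((T y).1, C y)` is a local `C^k` diffeomorphism at `x` by the inverse function theorem, and it
carries `Ω` near `x` to the slice `ℝⁿ⁻ᵐ × {0}` (`exists_isSliceChart`). The first components of these slice
charts form a `C^k` atlas of `Ω` for which the inclusion is a smooth embedding, and in a chart with
inverse `ψ` the induced metric is the Gram form of `Dψ`, hence `C^(k-1)`
(`contMDiff_inducedForm`, `exists_isEmbeddedRiemannianSubmanifold`).

*First order.* The `c i` are constant on `Ω`, so `T_x Ω` lies in the tangent subspace, and both have
dimension `n - m`. The multiplier is characterized by `∇ₓ L(x, μ)` being tangent, by Pythagoras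
(`isMultiplier_iff_eq`). As `∇ₓ L(x, μ) - ∇f(x)` is normal, `∇ₓ L(x, μ)` is the tangent vector which
represents `df` on `T_x Ω`.

*The connection.* Let `P` be the orthogonal projection to the tangent spaces. Then `∇_X Y = P (D_X Y)`
defines a Levi-Civita connection: it is metric by the product rule in `ℝⁿ`, and torsion-free since
the second derivative of the inclusion is symmetric (`mvfderiv_pushforwardField_sub`). Any
Levi-Civita connection agrees with it on differentiable fields (`IsLeviCivita.eq`).

*Second order.* No derivative of the multipliers is needed. Freeze `μ = μ(x)` and let
`G y = ∇ₓ L(y, μ)`. For every `y ∈ Ω` the tangential part of `G y` is `grad f (y)`, whatever `μ` is,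
and `G x` is itself tangent. Differentiating `⟪grad f, Z⟫ = ⟪G, Z⟫` for tangent fields `Z` in two ways,
the terms which contain a derivative of `Z` agree at `x`, which leaves
`⟪∇_ξ grad f, η⟫ = ⟪DG(x) ξ, η⟫` (`inner_cov_eq`), and `DG(x)` is the Hessian of the Lagrangian. The
field `grad f` is only known to be differentiable, since `f` is merely twice differentiable
(`mdifferentiableAt_of_inner_eq`).
-/

noncomputable section

/-! ### Functions and vector fields in charts -/

section Coordinates

open Set VectorField Topology

variable {E : Type*} [NormedAddCommGroup E] [NormedSpace ℝ E]
  {M : Type*} [TopologicalSpace M] [ChartedSpace E M]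
  {W : Type*} [NormedAddCommGroup W] [NormedSpace ℝ W]

/-- The vector field `Y` in the preferred chart at `x`, as a map `E → E`. -/
def chartCoord (x : M) (Y : Π y : M, TangentSpace 𝓘(ℝ, E) y) (u : E) : E :=
  mpullbackWithin 𝓘(ℝ, E) 𝓘(ℝ, E) (extChartAt 𝓘(ℝ, E) x).symm Y (range 𝓘(ℝ, E)) u

variable [IsManifold 𝓘(ℝ, E) 2 M]

theorem fderiv_comp_extChartAt_symm {g : M → W} {x : M} {u : E}
    (hu : u ∈ (extChartAt 𝓘(ℝ, E) x).target)
    (hg : MDiffAt g ((extChartAt 𝓘(ℝ, E) x).symm u)) :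
    fderiv ℝ (g ∘ (extChartAt 𝓘(ℝ, E) x).symm) u =
      mvfderiv 𝓘(ℝ, E) g ((extChartAt 𝓘(ℝ, E) x).symm u) ∘L
        mfderivWithin 𝓘(ℝ, E) 𝓘(ℝ, E) (extChartAt 𝓘(ℝ, E) x).symm (range 𝓘(ℝ, E)) u := by
  have h1 := mdifferentiableWithinAt_extChartAt_symm hu
  have h2 : MDifferentiableAt 𝓘(ℝ, E) 𝓘(ℝ, E) (extChartAt 𝓘(ℝ, E) x).symm u := by
    rw [modelWithCornersSelf_coe, range_id] at h1
    exact mdifferentiableWithinAt_univ.1 h1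
  have := mfderiv_comp u hg h2
  rw [mfderiv_eq_fderiv] at this
  rw [this]
  simp
  rfl

theorem fderiv_chartCoord {g : M → W} {x : M} {u : E} (Y : Π y : M, TangentSpace 𝓘(ℝ, E) y)
    (hu : u ∈ (extChartAt 𝓘(ℝ, E) x).target)
    (hg : MDiffAt g ((extChartAt 𝓘(ℝ, E) x).symm u)) :
    fderiv ℝ (g ∘ (extChartAt 𝓘(ℝ, E) x).symm) u (chartCoord x Y u) =
      mvfderiv 𝓘(ℝ, E) g ((extChartAt 𝓘(ℝ, E) x).symm u)
        (Y ((extChartAt 𝓘(ℝ, E) x).symm u)) := by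
  rw [fderiv_comp_extChartAt_symm hu hg]
  have := (isInvertible_mfderivWithin_extChartAt_symm hu).self_apply_inverse
    (Y ((extChartAt 𝓘(ℝ, E) x).symm u))
  exact congrArg (mvfderiv 𝓘(ℝ, E) g ((extChartAt 𝓘(ℝ, E) x).symm u)) this

theorem chartCoord_self (x : M) (Y : Π y : M, TangentSpace 𝓘(ℝ, E) y) :
    chartCoord x Y (extChartAt 𝓘(ℝ, E) x x) = Y x := by
  -- both values of `Y` live in `E`, which is every tangent space by definition
  have h : (Y ((extChartAt 𝓘(ℝ, E) x).symm (extChartAt 𝓘(ℝ, E) x x)) : E) = (Y x : E) :=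
    congrArg (fun y ↦ (Y y : E)) (extChartAt_to_inv x)
  have h' := mfderivWithin_extChartAt_symm_inverse_apply (I := 𝓘(ℝ, E)) (x := x) (Y x)
  exact Eq.trans (congrArg (mfderivWithin 𝓘(ℝ, E) 𝓘(ℝ, E) (extChartAt 𝓘(ℝ, E) x).symm
    (range 𝓘(ℝ, E)) (extChartAt 𝓘(ℝ, E) x x)).inverse h) h'

theorem differentiableAt_chartCoord [CompleteSpace E] {x : M}
    {Y : Π y : M, TangentSpace 𝓘(ℝ, E) y} (hY : MDiffAt (T% Y) x) :
    DifferentiableAt ℝ (chartCoord x Y) (extChartAt 𝓘(ℝ, E) x x) := by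
  have := (mdifferentiableWithinAt_univ.2 hY).differentiableWithinAt_mpullbackWithin_vectorField
  rw [preimage_univ, univ_inter] at this
  exact this.differentiableAt (by simp)

theorem mlieBracket_eq_lieBracket_chartCoord (X Y : Π y : M, TangentSpace 𝓘(ℝ, E) y) (x : M) :
    mlieBracket 𝓘(ℝ, E) X Y x =
      lieBracket ℝ (chartCoord x X) (chartCoord x Y) (extChartAt 𝓘(ℝ, E) x x) := by
  have h1 : (mfderiv 𝓘(ℝ, E) 𝓘(ℝ, E) (extChartAt 𝓘(ℝ, E) x) x).inverse =
      ContinuousLinearMap.id ℝ (TangentSpace 𝓘(ℝ, E) x) := by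
    refine (congrArg ContinuousLinearMap.inverse
      (mfderiv_extChartAt_self (I := 𝓘(ℝ, E)) (x := x))).trans ?_
    exact ContinuousLinearMap.inverse_id (R := ℝ) (M := E)
  have h2 : (extChartAt 𝓘(ℝ, E) x).symm ⁻¹' univ ∩ range 𝓘(ℝ, E) = univ := by simp
  have h3 : lieBracketWithin ℝ (chartCoord x X) (chartCoord x Y) univ
      (extChartAt 𝓘(ℝ, E) x x) =
        lieBracket ℝ (chartCoord x X) (chartCoord x Y) (extChartAt 𝓘(ℝ, E) x x) := by
    rw [lieBracketWithin_univ]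
  rw [← mlieBracketWithin_univ, mlieBracketWithin_apply, h2]
  exact (congrArg (fun A : E →L[ℝ] E ↦ A (lieBracketWithin ℝ (chartCoord x X) (chartCoord x Y)
    univ (extChartAt 𝓘(ℝ, E) x x))) h1).trans h3

omit [IsManifold 𝓘(ℝ, E) 2 M] in
theorem mvfderiv_eq_fderiv_comp_extChartAt_symm {g : M → W} {x : M} (hg : MDiffAt g x) :
    mvfderiv 𝓘(ℝ, E) g x = fderiv ℝ (g ∘ (extChartAt 𝓘(ℝ, E) x).symm) (extChartAt 𝓘(ℝ, E) x x) := by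
  rw [hg.mvfderiv]; simp [writtenInExtChartAt]; rfl

omit [IsManifold 𝓘(ℝ, E) 2 M] in
theorem ContMDiff.contDiffOn_comp_extChartAt_symm {n : ℕ∞ω} [IsManifold 𝓘(ℝ, E) n M] {g : M → W}
    (hg : ContMDiff 𝓘(ℝ, E) 𝓘(ℝ, W) n g) (x : M) :
    ContDiffOn ℝ n (g ∘ (extChartAt 𝓘(ℝ, E) x).symm) (extChartAt 𝓘(ℝ, E) x).target :=
  (hg.comp_contMDiffOn (contMDiffOn_extChartAt_symm x)).contDiffOn

theorem mdifferentiableAt_of_comp_extChartAt_symm {g : M → W} {x : M}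
    (hg : DifferentiableAt ℝ (g ∘ (extChartAt 𝓘(ℝ, E) x).symm) (extChartAt 𝓘(ℝ, E) x x)) :
    MDiffAt g x := by
  have h1 : MDifferentiableAt 𝓘(ℝ, E) 𝓘(ℝ, E) (extChartAt 𝓘(ℝ, E) x) x :=
    mdifferentiableAt_extChartAt (by simp)
  refine (MDifferentiableAt.comp x hg.mdifferentiableAt h1).congr_of_eventuallyEq ?_
  filter_upwards [extChartAt_source_mem_nhds (I := 𝓘(ℝ, E)) x] with y hy
  simp only [Function.comp_apply, (extChartAt 𝓘(ℝ, E) x).left_inv hy]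

end Coordinates

/-! ### Pushing vector fields forward to a vector space -/

section Pushforward

open Set VectorField Topology

variable {E : Type*} [NormedAddCommGroup E] [NormedSpace ℝ E]
  {M : Type*} [TopologicalSpace M] [ChartedSpace E M] [IsManifold 𝓘(ℝ, E) 2 M]
  {W : Type*} [NormedAddCommGroup W] [NormedSpace ℝ W]
  {g : M → W} {x : M} {X Y : Π y : M, TangentSpace 𝓘(ℝ, E) y}

/-- A vector field on `M` pushed forward by `g : M → W`, as a function on `M` with values
in the vector space `W`. -/
def pushforwardField (g : M → W) (Y : Π y : M, TangentSpace 𝓘(ℝ, E) y) (y : M) : W :=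
  mvfderiv 𝓘(ℝ, E) g y (Y y)

theorem pushforwardField_comp_extChartAt_symm (hg : ContMDiff 𝓘(ℝ, E) 𝓘(ℝ, W) 2 g) (x : M)
    (Y : Π y : M, TangentSpace 𝓘(ℝ, E) y) :
    pushforwardField g Y ∘ (extChartAt 𝓘(ℝ, E) x).symm =ᶠ[𝓝 (extChartAt 𝓘(ℝ, E) x x)]
      fun u ↦ fderiv ℝ (g ∘ (extChartAt 𝓘(ℝ, E) x).symm) u (chartCoord x Y u) := by
  filter_upwards [extChartAt_target_mem_nhds (I := 𝓘(ℝ, E)) x] with u hu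
  exact (fderiv_chartCoord Y hu (hg.mdifferentiableAt two_ne_zero)).symm

theorem ContMDiff.differentiableAt_fderiv_comp_extChartAt_symm
    (hg : ContMDiff 𝓘(ℝ, E) 𝓘(ℝ, W) 2 g) (x : M) :
    DifferentiableAt ℝ (fderiv ℝ (g ∘ (extChartAt 𝓘(ℝ, E) x).symm)) (extChartAt 𝓘(ℝ, E) x x) :=
  (((hg.contDiffOn_comp_extChartAt_symm x).contDiffAt (extChartAt_target_mem_nhds x)).fderiv_right
    (m := 1) (by norm_num)).differentiableAt one_ne_zero

variable [CompleteSpace E]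

theorem mdifferentiableAt_pushforwardField (hg : ContMDiff 𝓘(ℝ, E) 𝓘(ℝ, W) 2 g)
    (hY : MDiffAt (T% Y) x) : MDiffAt (pushforwardField g Y) x := by
  refine mdifferentiableAt_of_comp_extChartAt_symm ?_
  refine DifferentiableAt.congr_of_eventuallyEq ?_ (pushforwardField_comp_extChartAt_symm hg x Y)
  exact (hg.differentiableAt_fderiv_comp_extChartAt_symm x).clm_apply (differentiableAt_chartCoord hY)

/-- The derivative of the pushed forward field in the preferred chart, by the product rule. -/
theorem mvfderiv_pushforwardField (hg : ContMDiff 𝓘(ℝ, E) 𝓘(ℝ, W) 2 g)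
    (hY : MDiffAt (T% Y) x) (v : E) :
    mvfderiv 𝓘(ℝ, E) (pushforwardField g Y) x v =
      fderiv ℝ (fderiv ℝ (g ∘ (extChartAt 𝓘(ℝ, E) x).symm)) (extChartAt 𝓘(ℝ, E) x x) v
        (chartCoord x Y (extChartAt 𝓘(ℝ, E) x x)) +
      fderiv ℝ (g ∘ (extChartAt 𝓘(ℝ, E) x).symm) (extChartAt 𝓘(ℝ, E) x x)
        (fderiv ℝ (chartCoord x Y) (extChartAt 𝓘(ℝ, E) x x) v) := by
  have h1 := mvfderiv_eq_fderiv_comp_extChartAt_symm (mdifferentiableAt_pushforwardField hg hY)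
  have h2 := (pushforwardField_comp_extChartAt_symm hg x Y).fderiv_eq (𝕜 := ℝ)
  rw [fderiv_clm_apply (hg.differentiableAt_fderiv_comp_extChartAt_symm x)
    (differentiableAt_chartCoord hY)] at h2
  have h3 := congrArg (fun A : E →L[ℝ] W ↦ A v) (h1.trans h2)
  refine h3.trans ?_
  simp [add_comm]

/-- Second derivatives being symmetric, the antisymmetrised derivative of pushed forward fields is
the pushforward of the Lie bracket. -/
theorem mvfderiv_pushforwardField_sub (hg : ContMDiff 𝓘(ℝ, E) 𝓘(ℝ, W) 2 g)
    (hX : MDiffAt (T% X) x) (hY : MDiffAt (T% Y) x) :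
    mvfderiv 𝓘(ℝ, E) (pushforwardField g Y) x (X x) -
      mvfderiv 𝓘(ℝ, E) (pushforwardField g X) x (Y x) =
      mvfderiv 𝓘(ℝ, E) g x (mlieBracket 𝓘(ℝ, E) X Y x) := by
  -- in the chart the left side is `D²g(X, Y) - D²g(Y, X) + Dg(DY X - DX Y)`, with symmetric `D²g`
  have hs : IsSymmSndFDerivAt ℝ (g ∘ (extChartAt 𝓘(ℝ, E) x).symm) (extChartAt 𝓘(ℝ, E) x x) :=
    ((hg.contDiffOn_comp_extChartAt_symm x).contDiffAt
      (extChartAt_target_mem_nhds x)).isSymmSndFDerivAt (by simp)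
  have h1 := mvfderiv_pushforwardField hg hY (X x)
  have h2 := mvfderiv_pushforwardField hg hX (Y x)
  have h3 : mvfderiv 𝓘(ℝ, E) g x (mlieBracket 𝓘(ℝ, E) X Y x) =
      fderiv ℝ (g ∘ (extChartAt 𝓘(ℝ, E) x).symm) (extChartAt 𝓘(ℝ, E) x x)
        (lieBracket ℝ (chartCoord x X) (chartCoord x Y) (extChartAt 𝓘(ℝ, E) x x)) := by
    rw [mlieBracket_eq_lieBracket_chartCoord,
      mvfderiv_eq_fderiv_comp_extChartAt_symm (hg.mdifferentiableAt two_ne_zero)]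
    rfl
  have h4 := hs.eq (X x) (Y x)
  rw [h3, h1, h2, lieBracket, chartCoord_self, chartCoord_self, map_sub]
  refine (congrArg₂ (· - ·) (congrArg (· + _) h4) rfl).trans ?_
  exact add_sub_add_left_eq_sub _ _ _

end Pushforward

/-! ### Uniqueness of the Levi-Civita connection -/

section LeviCivita

variable {E : Type*} [NormedAddCommGroup E] [NormedSpace ℝ E]
  {M : Type*} [TopologicalSpace M] [ChartedSpace E M] [IsManifold 𝓘(ℝ, E) 2 M]
  [Bundle.RiemannianBundle (fun x : M ↦ TangentSpace 𝓘(ℝ, E) x)]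

/-- Uniqueness of the Levi-Civita connection. If `D` is the difference of two such connections,
`⟪D_X Y, Z⟫` is symmetric in `X, Y` since both are torsion-free and antisymmetric in `Y, Z` since
both are metric, hence it vanishes. -/
theorem IsLeviCivita.eq
    {cov cov' : CovariantDerivative 𝓘(ℝ, E) E (fun x : M ↦ TangentSpace 𝓘(ℝ, E) x)}
    (h : IsLeviCivita cov) (h' : IsLeviCivita cov')
    {Y : Π x : M, TangentSpace 𝓘(ℝ, E) x} {x : M} (hY : MDiffAt (T% Y) x) :
    cov Y x = cov' Y x := by
  let B (X Y Z : Π x : M, TangentSpace 𝓘(ℝ, E) x) : ℝ :=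
    inner ℝ (cov Y x (X x)) (Z x) - inner ℝ (cov' Y x (X x)) (Z x)
  have symm {X Y Z : Π x : M, TangentSpace 𝓘(ℝ, E) x} (hX : MDiffAt (T% X) x)
      (hY : MDiffAt (T% Y) x) : B X Y Z = B Y X Z := by
    have h1 := congrArg (fun v ↦ inner ℝ v (Z x)) (h.torsion_free hX hY)
    have h2 := congrArg (fun v ↦ inner ℝ v (Z x)) (h'.torsion_free hX hY)
    simp only [inner_sub_left] at h1 h2
    simp only [B]
    linarith
  have antisymm {X Y Z : Π x : M, TangentSpace 𝓘(ℝ, E) x} (hX : MDiffAt (T% X) x)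
      (hY : MDiffAt (T% Y) x) (hZ : MDiffAt (T% Z) x) : B X Y Z = - B X Z Y := by
    have h1 := h.metric hX hY hZ
    have h2 := h'.metric hX hY hZ
    rw [real_inner_comm _ (Y x)] at h1 h2
    simp only [B]
    linarith
  have zero {X Y Z : Π x : M, TangentSpace 𝓘(ℝ, E) x} (hX : MDiffAt (T% X) x)
      (hY : MDiffAt (T% Y) x) (hZ : MDiffAt (T% Z) x) : B X Y Z = 0 := by
    have e1 := symm (Z := Z) hX hY
    have e2 := antisymm hY hX hZ
    have e3 := symm (Z := X) hY hZ
    have e4 := antisymm hZ hY hX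
    have e5 := symm (Z := Y) hZ hX
    have e6 := antisymm hX hZ hY
    linarith
  ext v
  refine ext_inner_right ℝ fun w ↦ ?_
  have hv := FiberBundle.mdifferentiableAt_extend 𝓘(ℝ, E) E (V := TangentSpace 𝓘(ℝ, E) (M := M)) v
  have hw := FiberBundle.mdifferentiableAt_extend 𝓘(ℝ, E) E (V := TangentSpace 𝓘(ℝ, E) (M := M)) w
  have := zero hv hY hw
  simp only [B, FiberBundle.extend_apply_self] at this
  linarith

end LeviCivita

/-! ### Differentiability in charts -/

section DifferentiabilityInCharts

open Set VectorField Topology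

variable {E : Type*} [NormedAddCommGroup E] [NormedSpace ℝ E]
  {M : Type*} [TopologicalSpace M] [ChartedSpace E M] [IsManifold 𝓘(ℝ, E) 2 M]
  {W : Type*} [NormedAddCommGroup W] [InnerProductSpace ℝ W] {x : M}

theorem MDifferentiableAt.differentiableAt_comp_extChartAt_symm {W : Type*}
    [NormedAddCommGroup W] [NormedSpace ℝ W] {g : M → W} (hg : MDiffAt g x) :
    DifferentiableAt ℝ (g ∘ (extChartAt 𝓘(ℝ, E) x).symm) (extChartAt 𝓘(ℝ, E) x x) := by
  have h1 := mdifferentiableWithinAt_extChartAt_symm (I := 𝓘(ℝ, E)) (mem_extChartAt_target x)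
  rw [modelWithCornersSelf_coe, range_id] at h1
  rw [← extChartAt_to_inv (I := 𝓘(ℝ, E)) x] at hg
  exact (hg.comp _ (mdifferentiableWithinAt_univ.1 h1)).differentiableAt

theorem mvfderiv_inner {a b : M → W} (ha : MDiffAt a x) (hb : MDiffAt b x)
    (v : TangentSpace 𝓘(ℝ, E) x) :
    mvfderiv 𝓘(ℝ, E) (fun y ↦ ⟪a y, b y⟫) x v =
      ⟪mvfderiv 𝓘(ℝ, E) a x v, b x⟫ + ⟪a x, mvfderiv 𝓘(ℝ, E) b x v⟫ := by
  have ha' := ha.differentiableAt_comp_extChartAt_symm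
  have hb' := hb.differentiableAt_comp_extChartAt_symm
  have hab : MDiffAt (fun y ↦ ⟪a y, b y⟫) x :=
    mdifferentiableAt_of_comp_extChartAt_symm (ha'.inner ℝ hb')
  have := fderiv_inner_apply ℝ ha' hb' v
  rw [mvfderiv_eq_fderiv_comp_extChartAt_symm hab, mvfderiv_eq_fderiv_comp_extChartAt_symm ha,
    mvfderiv_eq_fderiv_comp_extChartAt_symm hb]
  refine this.trans ?_
  simp only [Function.comp_apply, extChartAt_to_inv]
  exact add_comm _ _

theorem mvfderiv_comp_val {V : Type*} [NormedAddCommGroup V] [NormedSpace ℝ V]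
    {E : Type*} [NormedAddCommGroup E] [NormedSpace ℝ E] {S : Set V} [ChartedSpace E S] {x : S}
    {W : Type*} [NormedAddCommGroup W] [NormedSpace ℝ W] {g : V → W} (hg : DifferentiableAt ℝ g x)
    (hι : MDifferentiableAt 𝓘(ℝ, E) 𝓘(ℝ, V) (Subtype.val : S → V) x) (v : TangentSpace 𝓘(ℝ, E) x) :
    mvfderiv 𝓘(ℝ, E) (fun y : S ↦ g y) x v =
      fderiv ℝ g x (mvfderiv 𝓘(ℝ, E) (Subtype.val : S → V) x v) := by
  have := mfderiv_comp x hg.mdifferentiableAt hι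
  rw [mfderiv_eq_fderiv] at this
  exact congrArg (fun A : E →L[ℝ] W ↦ A v) this

/-- The two ways of writing a vector field in a chart, through the trivialization of the tangent
bundle and by pullback along the inverse chart, agree. -/
theorem trivializationAt_apply_comp_extChartAt_symm (Y : Π y : M, TangentSpace 𝓘(ℝ, E) y) {u : E}
    (hu : u ∈ (extChartAt 𝓘(ℝ, E) x).target) :
    (trivializationAt E (TangentSpace 𝓘(ℝ, E)) x
      ⟨(extChartAt 𝓘(ℝ, E) x).symm u, Y ((extChartAt 𝓘(ℝ, E) x).symm u)⟩).2 =
      chartCoord x Y u := by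
  have hy : (extChartAt 𝓘(ℝ, E) x).symm u ∈ (chartAt E x).source := by
    simpa using (extChartAt 𝓘(ℝ, E) x).map_target hu
  have h1 := TangentBundle.continuousLinearMapAt_trivializationAt (I := 𝓘(ℝ, E)) hy
  have h2 : (trivializationAt E (TangentSpace 𝓘(ℝ, E)) x
      ⟨(extChartAt 𝓘(ℝ, E) x).symm u, Y ((extChartAt 𝓘(ℝ, E) x).symm u)⟩).2 =
      (trivializationAt E (TangentSpace 𝓘(ℝ, E)) x).continuousLinearMapAt ℝ
        ((extChartAt 𝓘(ℝ, E) x).symm u) (Y ((extChartAt 𝓘(ℝ, E) x).symm u)) := by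
    rw [Bundle.Trivialization.continuousLinearMapAt_apply, Bundle.Trivialization.coe_linearMapAt_of_mem]
    simpa using hy
  rw [h2, h1]
  refine ((isInvertible_mfderivWithin_extChartAt_symm hu).inverse_apply_eq.2 ?_).symm
  have := mfderivWithin_extChartAt_symm_comp_mfderiv_extChartAt (I := 𝓘(ℝ, E)) hu
  exact (congrArg (fun A : TangentSpace 𝓘(ℝ, E) ((extChartAt 𝓘(ℝ, E) x).symm u) →L[ℝ]
    TangentSpace 𝓘(ℝ, E) ((extChartAt 𝓘(ℝ, E) x).symm u) ↦
      A (Y ((extChartAt 𝓘(ℝ, E) x).symm u))) this).symm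

theorem mdifferentiableAt_of_differentiableAt_chartCoord {Y : Π y : M, TangentSpace 𝓘(ℝ, E) y}
    (hY : DifferentiableAt ℝ (chartCoord x Y) (extChartAt 𝓘(ℝ, E) x x)) : MDiffAt (T% Y) x := by
  rw [mdifferentiableAt_section]
  refine mdifferentiableAt_of_comp_extChartAt_symm (hY.congr_of_eventuallyEq ?_)
  filter_upwards [extChartAt_target_mem_nhds (I := 𝓘(ℝ, E)) x] with u hu
  exact trivializationAt_apply_comp_extChartAt_symm Y hu

end DifferentiabilityInCharts

/-! ### Gram forms -/

section Gram

variable {E : Type*} [NormedAddCommGroup E] [NormedSpace ℝ E]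
  {V : Type*} [NormedAddCommGroup V] [InnerProductSpace ℝ V]

/-- The inner product of `V` pulled back along `A : E → V`, as a bilinear form on `E`. -/
def gramForm (A : E →L[ℝ] V) : E →L[ℝ] E →L[ℝ] ℝ :=
  (ContinuousLinearMap.compL ℝ E V ℝ).flip A ∘L (innerSL ℝ ∘L A)

@[simp] theorem gramForm_apply (A : E →L[ℝ] V) (u v : E) : gramForm A u v = ⟪A u, A v⟫ := rfl

theorem contDiff_gramForm {n : ℕ∞ω} : ContDiff ℝ n (gramForm : (E →L[ℝ] V) → _) := by
  unfold gramForm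
  fun_prop

theorem DifferentiableAt.inverse_apply {D F : Type*} [NormedAddCommGroup D] [NormedSpace ℝ D]
    [NormedAddCommGroup F] [NormedSpace ℝ F] [CompleteSpace E] {B : D → E →L[ℝ] F} {b : D → F}
    {x : D} (hB : DifferentiableAt ℝ B x) (hb : DifferentiableAt ℝ b x) (hx : (B x).IsInvertible) :
    DifferentiableAt ℝ (fun u ↦ (B u).inverse (b u)) x :=
  (((hx.contDiffAt_map_inverse (n := 1)).differentiableAt one_ne_zero).comp x hB).clm_apply hb

theorem isInvertible_gramForm [FiniteDimensional ℝ E] {A : E →L[ℝ] V}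
    (hA : Function.Injective A) : (gramForm A).IsInvertible := by
  have hinj : Function.Injective (gramForm A : E →ₗ[ℝ] E →L[ℝ] ℝ) := by
    refine (injective_iff_map_eq_zero _).2 fun u hu ↦ hA ?_
    have := congrArg (fun B : E →L[ℝ] ℝ ↦ B u) hu
    simpa using this
  have hdim : Module.finrank ℝ E = Module.finrank ℝ (E →L[ℝ] ℝ) := by
    rw [← (LinearMap.toContinuousLinearMap (𝕜 := ℝ) (E := E) (F' := ℝ)).finrank_eq]
    exact Subspace.dual_finrank_eq.symm
  exact ⟨(LinearEquiv.ofInjectiveOfFinrankEq _ hinj hdim).toContinuousLinearEquiv, by ext; rfl⟩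

end Gram

/-! ### Connections on an embedded Riemannian submanifold -/

section Submanifold

open Set VectorField Topology

variable {V : Type*} [NormedAddCommGroup V] [InnerProductSpace ℝ V]
  {E : Type*} [NormedAddCommGroup E] [NormedSpace ℝ E] {k : ℕ∞} {S : Set V} [ChartedSpace E S]
  [IsManifold 𝓘(ℝ, E) 2 S] [Bundle.RiemannianBundle (fun x : S ↦ TangentSpace 𝓘(ℝ, E) x)]

namespace IsEmbeddedRiemannianSubmanifold

variable (h : IsEmbeddedRiemannianSubmanifold E k S) (hk : 2 ≤ k)
include h

theorem inclusionDeriv_injective (x : S) :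
    Function.Injective (inclusionDeriv (E := E) x) := by
  refine (injective_iff_map_eq_zero _).2 fun v hv ↦ ?_
  have := h.inner_eq x v v
  rw [hv, inner_zero_left] at this
  exact inner_self_eq_zero.1 this

include hk in
theorem contMDiff_val : ContMDiff 𝓘(ℝ, E) 𝓘(ℝ, V) 2 (Subtype.val : S → V) :=
  h.isSmoothEmbedding.contMDiff.of_le (WithTop.coe_le_coe.2 hk)

theorem injective_fderiv_val_comp_extChartAt_symm (x : S) {u : E} (hk : 2 ≤ k)
    (hu : u ∈ (extChartAt 𝓘(ℝ, E) x).target) :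
    Function.Injective (fderiv ℝ (Subtype.val ∘ (extChartAt 𝓘(ℝ, E) x).symm : E → V) u) := by
  rw [fderiv_comp_extChartAt_symm hu ((h.contMDiff_val hk).mdifferentiableAt two_ne_zero)]
  exact (h.inclusionDeriv_injective _).comp (isInvertible_mfderivWithin_extChartAt_symm hu).injective

/-- A vector field is differentiable at `x` as soon as it represents, for the metric, the
restriction to the tangent spaces of a family of linear forms on `V` differentiable at `x`: in a
chart it is obtained by inverting the Gram form of the parametrization. -/
theorem mdifferentiableAt_of_inner_eq [FiniteDimensional ℝ E] (hk : 2 ≤ k)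
    {Y : Π y : S, TangentSpace 𝓘(ℝ, E) y}
    {α : S → V →L[ℝ] ℝ} {x : S} (hα : MDiffAt α x)
    (hY : ∀ y (w : TangentSpace 𝓘(ℝ, E) y), inner ℝ (Y y) w = α y (inclusionDeriv y w)) :
    MDiffAt (T% Y) x := by
  set ψ := (extChartAt 𝓘(ℝ, E) x).symm with hψ
  set A : E → E →L[ℝ] V := fderiv ℝ (Subtype.val ∘ ψ) with hA
  have hAd : DifferentiableAt ℝ A (extChartAt 𝓘(ℝ, E) x x) :=
    (h.contMDiff_val hk).differentiableAt_fderiv_comp_extChartAt_symm x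
  have hinv : ∀ u ∈ (extChartAt 𝓘(ℝ, E) x).target, (gramForm (A u)).IsInvertible := fun u hu ↦
    isInvertible_gramForm (h.injective_fderiv_val_comp_extChartAt_symm x hk hu)
  have hcoord : chartCoord x Y =ᶠ[𝓝 (extChartAt 𝓘(ℝ, E) x x)]
      fun u ↦ (gramForm (A u)).inverse ((α ∘ ψ) u ∘L A u) := by
    filter_upwards [extChartAt_target_mem_nhds (I := 𝓘(ℝ, E)) x] with u hu
    refine ((hinv u hu).inverse_apply_eq.2 ?_).symm
    ext w
    have hι := (h.contMDiff_val hk).mdifferentiableAt (x := ψ u) two_ne_zero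
    have h1 : A u (chartCoord x Y u) = inclusionDeriv (ψ u) (Y (ψ u)) := fderiv_chartCoord Y hu hι
    have h2 : A u w = inclusionDeriv (ψ u)
        (mfderivWithin 𝓘(ℝ, E) 𝓘(ℝ, E) ψ (range 𝓘(ℝ, E)) u w) :=
      congrArg (fun B : E →L[ℝ] V ↦ B w) (fderiv_comp_extChartAt_symm hu hι)
    rw [gramForm_apply, h1, ContinuousLinearMap.comp_apply, h2, ← h.inner_eq, hY]
    rfl
  refine mdifferentiableAt_of_differentiableAt_chartCoord
    (DifferentiableAt.congr_of_eventuallyEq ?_ hcoord)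
  have := FiniteDimensional.complete ℝ E
  exact (((contDiff_gramForm (n := 1)).differentiable one_ne_zero).differentiableAt.comp _
    hAd).inverse_apply (hα.differentiableAt_comp_extChartAt_symm.clm_comp hAd)
      (hinv _ (mem_extChartAt_target x))

end IsEmbeddedRiemannianSubmanifold

variable [FiniteDimensional ℝ E]

/-- The orthogonal projection `V → T_x S`, the adjoint of the differential of the inclusion. -/
def tangentialPart [FiniteDimensional ℝ V] (x : S) : V →L[ℝ] TangentSpace 𝓘(ℝ, E) x :=
  haveI : FiniteDimensional ℝ (TangentSpace 𝓘(ℝ, E) x) := inferInstanceAs (FiniteDimensional ℝ E)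
  haveI : CompleteSpace (TangentSpace 𝓘(ℝ, E) x) := FiniteDimensional.complete ℝ _
  (inclusionDeriv (E := E) x).adjoint

omit [IsManifold 𝓘(ℝ, E) 2 S] in
theorem inner_tangentialPart [FiniteDimensional ℝ V] (x : S) (w : V) (v : TangentSpace 𝓘(ℝ, E) x) :
    inner ℝ (tangentialPart x w) v = ⟪w, inclusionDeriv x v⟫ := by
  have : FiniteDimensional ℝ (TangentSpace 𝓘(ℝ, E) x) := inferInstanceAs (FiniteDimensional ℝ E)
  have : CompleteSpace (TangentSpace 𝓘(ℝ, E) x) := FiniteDimensional.complete ℝ _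
  exact ContinuousLinearMap.adjoint_inner_left _ _ _

namespace IsEmbeddedRiemannianSubmanifold

variable [FiniteDimensional ℝ V] (h : IsEmbeddedRiemannianSubmanifold E k S) (hk : 2 ≤ k)
include h

theorem tangentialPart_inclusionDeriv (x : S) (v : TangentSpace 𝓘(ℝ, E) x) :
    tangentialPart x (inclusionDeriv x v) = v :=
  ext_inner_right ℝ fun w ↦ by rw [inner_tangentialPart, h.inner_eq]

/-- The tangential connection `∇_X Y = P (D_X Y)`: differentiate `Y` as a map with values in the
ambient space and project the result to the tangent space. -/
def tangentialConnection :
    CovariantDerivative 𝓘(ℝ, E) E (fun x : S ↦ TangentSpace 𝓘(ℝ, E) x) where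
  toFun Y x := tangentialPart x ∘L mvfderiv 𝓘(ℝ, E) (pushforwardField Subtype.val Y) x
  isCovariantDerivativeOnUniv := {
    add := fun {σ σ' x} hσ hσ' _ ↦ by
      have hι := h.contMDiff_val hk
      have : pushforwardField (Subtype.val : S → V) (σ + σ') =
          pushforwardField Subtype.val σ + pushforwardField Subtype.val σ' := by
        ext y : 1
        exact map_add (inclusionDeriv y) _ _
      rw [this, mvfderiv_add (mdifferentiableAt_pushforwardField hι hσ)
        (mdifferentiableAt_pushforwardField hι hσ'), ContinuousLinearMap.comp_add]
    leibniz := fun {σ g x} hσ hg _ ↦ by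
      have hι := h.contMDiff_val hk
      have : pushforwardField (Subtype.val : S → V) (g • σ) =
          g • pushforwardField Subtype.val σ := by
        ext y : 1
        exact map_smul (inclusionDeriv y) _ _
      rw [this, mvfderiv_smul hg (mdifferentiableAt_pushforwardField hι hσ)]
      ext v
      have := h.tangentialPart_inclusionDeriv x (σ x)
      simp only [ContinuousLinearMap.comp_apply, _root_.add_apply,
        _root_.smul_apply, ContinuousLinearMap.smulRight_apply, map_add, map_smul]
      congr 2 }

theorem tangentialConnection_apply (Y : Π x : S, TangentSpace 𝓘(ℝ, E) x) (x : S)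
    (v : TangentSpace 𝓘(ℝ, E) x) :
    h.tangentialConnection hk Y x v =
      tangentialPart x (mvfderiv 𝓘(ℝ, E) (pushforwardField Subtype.val Y) x v) := rfl

theorem isLeviCivita_tangentialConnection : IsLeviCivita (h.tangentialConnection hk) where
  metric {x X Y Z} _ hY hZ := by
    have hι := h.contMDiff_val hk
    have h1 : (fun y ↦ inner ℝ (Y y) (Z y)) = fun y ↦
        ⟪pushforwardField Subtype.val Y y, pushforwardField Subtype.val Z y⟫ :=
      funext fun y ↦ h.inner_eq y _ _
    rw [h1, mvfderiv_inner (mdifferentiableAt_pushforwardField hι hY)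
      (mdifferentiableAt_pushforwardField hι hZ), real_inner_comm _ (Y x),
      tangentialConnection_apply, tangentialConnection_apply, inner_tangentialPart,
      inner_tangentialPart, real_inner_comm _ (pushforwardField Subtype.val Y x)]
    rfl
  torsion_free {X Y x} hX hY := by
    rw [tangentialConnection_apply, tangentialConnection_apply, ← map_sub,
      mvfderiv_pushforwardField_sub (h.contMDiff_val hk) hX hY]
    exact h.tangentialPart_inclusionDeriv x _

/-- The Levi-Civita derivative of a vector field `Y` may be computed from any ambient field `G`
whose tangential part is `Y` along `S`, and which agrees with `Y` at the point considered: the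
normal component of `G` vanishes there, so that its derivative does not contribute. -/
theorem inner_cov_eq (hk : 2 ≤ k)
    {cov : CovariantDerivative 𝓘(ℝ, E) E (fun x : S ↦ TangentSpace 𝓘(ℝ, E) x)}
    (hcov : IsLeviCivita cov) {Y : Π x : S, TangentSpace 𝓘(ℝ, E) x} {x : S}
    (hYd : MDiffAt (T% Y) x) {G : V → V} (hG : DifferentiableAt ℝ G x)
    (hY : ∀ (y : S) (w : TangentSpace 𝓘(ℝ, E) y), inner ℝ (Y y) w = ⟪G y, inclusionDeriv y w⟫)
    (hx : inclusionDeriv x (Y x) = G x) (ξ η : TangentSpace 𝓘(ℝ, E) x) :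
    inner ℝ (cov Y x ξ) η = ⟪fderiv ℝ G x (inclusionDeriv x ξ), inclusionDeriv x η⟫ := by
  have hι := h.contMDiff_val hk
  -- extend `ξ` and `η` to vector fields `X` and `Z` and differentiate `⟪Y, Z⟫` in two ways
  let X : Π x : S, TangentSpace 𝓘(ℝ, E) x := FiberBundle.extend E ξ
  let Z : Π x : S, TangentSpace 𝓘(ℝ, E) x := FiberBundle.extend E η
  have hX : MDiffAt (T% X) x := FiberBundle.mdifferentiableAt_extend 𝓘(ℝ, E) E ξ
  have hZ : MDiffAt (T% Z) x := FiberBundle.mdifferentiableAt_extend 𝓘(ℝ, E) E η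
  have hXx : X x = ξ := FiberBundle.extend_apply_self E ξ
  have hZx : Z x = η := FiberBundle.extend_apply_self E η
  have hGm : MDiffAt (G ∘ Subtype.val : S → V) x :=
    MDifferentiableAt.comp x hG.mdifferentiableAt (hι.mdifferentiableAt two_ne_zero)
  have h1 := hcov.metric hX hYd hZ
  have h2 : (fun y ↦ inner ℝ (Y y) (Z y)) = fun y ↦
      ⟪(G ∘ Subtype.val) y, pushforwardField Subtype.val Z y⟫ := funext fun y ↦ hY y _
  -- the terms `⟪G x, ∇_ξ Z⟫` and `⟪G x, d(Z) ξ⟫` agree because `G x` is tangent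
  rw [h2, mvfderiv_inner hGm (mdifferentiableAt_pushforwardField hι hZ),
    hcov.eq (h.isLeviCivita_tangentialConnection hk) hZ, real_inner_comm _ (Y x),
    tangentialConnection_apply, inner_tangentialPart, hx, real_inner_comm (G x),
    hXx, hZx] at h1
  have h3 : mvfderiv 𝓘(ℝ, E) (G ∘ Subtype.val : S → V) x ξ =
      fderiv ℝ G x (inclusionDeriv x ξ) :=
    mvfderiv_comp_val hG (hι.mdifferentiableAt two_ne_zero) ξ
  rw [h3] at h1
  have h4 : pushforwardField Subtype.val Z x = inclusionDeriv x η := by rw [← hZx]; rfl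
  rw [h4] at h1
  simp only [Function.comp_apply] at h1
  linarith

end IsEmbeddedRiemannianSubmanifold

end Submanifold

/-! ### Lagrange multipliers -/

section Multipliers

variable {n m : ℕ} {f : EuclideanSpace ℝ (Fin n) → ℝ} {c : Fin m → EuclideanSpace ℝ (Fin n) → ℝ}
  {x : EuclideanSpace ℝ (Fin n)}

theorem differentiableAt_gradient {V : Type*} [NormedAddCommGroup V] [InnerProductSpace ℝ V]
    [CompleteSpace V] {g : V → ℝ} {x : V} (hg : DifferentiableAt ℝ (fderiv ℝ g) x) :
    DifferentiableAt ℝ (gradient g) x := by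
  let T : (V →L[ℝ] ℝ) ≃ₗᵢ[ℝ] V := (InnerProductSpace.toDual ℝ V).symm
  exact T.differentiable.differentiableAt.comp x hg

theorem gradLagrangian_eq (hf : DifferentiableAt ℝ f x) (hc : ∀ i, DifferentiableAt ℝ (c i) x)
    (ν : EuclideanSpace ℝ (Fin m)) :
    gradLagrangian f c x ν = gradient f x - ∑ i, ν i • gradient (c i) x := by
  refine ext_inner_right ℝ fun v ↦ ?_
  have h := hf.hasFDerivAt.sub (HasFDerivAt.fun_sum (u := Finset.univ)
    fun i _ ↦ (hc i).hasFDerivAt.const_mul (ν i))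
  rw [gradLagrangian, inner_gradient_left, inner_sub_left, sum_inner, inner_gradient_left]
  have h' : fderiv ℝ (fun y ↦ lagrangian f c y ν) x = _ := h.fderiv
  rw [h']
  simp [inner_smul_left, inner_gradient_left]

theorem mem_tangentSubspace {v : EuclideanSpace ℝ (Fin n)} :
    v ∈ tangentSubspace c x ↔ ∀ i, fderiv ℝ (c i) x v = 0 := by
  refine ⟨fun h i ↦ ?_, fun h ↦ (Submodule.mem_orthogonal _ _).2 fun w hw ↦ ?_⟩
  · rw [← inner_gradient_left]
    exact (Submodule.mem_orthogonal _ _).1 h _ (Submodule.subset_span ⟨i, rfl⟩)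
  · induction hw using Submodule.span_induction with
    | mem w hw => obtain ⟨i, rfl⟩ := hw; rw [inner_gradient_left, h]
    | zero => exact inner_zero_left v
    | add a b _ _ ha hb => rw [inner_add_left, ha, hb, add_zero]
    | smul r a _ ha => rw [inner_smul_left, ha, mul_zero]

/-- A multiplier with tangential Lagrangian gradient gives an orthogonal decomposition of all
Lagrangian gradients. -/
theorem norm_gradLagrangian_sq (hf : DifferentiableAt ℝ f x)
    (hc : ∀ i, DifferentiableAt ℝ (c i) x) {ν₀ : EuclideanSpace ℝ (Fin m)}
    (h₀ : gradLagrangian f c x ν₀ ∈ tangentSubspace c x) (ν : EuclideanSpace ℝ (Fin m)) :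
    ‖gradLagrangian f c x ν‖ ^ 2 =
      ‖gradLagrangian f c x ν₀‖ ^ 2 + ‖∑ i, (ν₀ - ν) i • gradient (c i) x‖ ^ 2 := by
  have hN : ∑ i, (ν₀ - ν) i • gradient (c i) x ∈ normalSubspace c x :=
    Submodule.sum_mem _ fun i _ ↦ Submodule.smul_mem _ _ (Submodule.subset_span ⟨i, rfl⟩)
  have h : gradLagrangian f c x ν =
      gradLagrangian f c x ν₀ + ∑ i, (ν₀ - ν) i • gradient (c i) x := by
    simp only [gradLagrangian_eq hf hc, PiLp.sub_apply, sub_smul, Finset.sum_sub_distrib]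
    abel
  have h0 := Submodule.inner_left_of_mem_orthogonal hN h₀
  rw [h, pow_two, pow_two, pow_two, norm_add_sq_eq_norm_sq_add_norm_sq_of_inner_eq_zero _ _ h0]

/-- The multipliers are the coefficients of the projection of `∇f` to the normal subspace. -/
theorem exists_gradLagrangian_mem_tangentSubspace (hf : DifferentiableAt ℝ f x)
    (hc : ∀ i, DifferentiableAt ℝ (c i) x) :
    ∃ ν₀, gradLagrangian f c x ν₀ ∈ tangentSubspace c x := by
  obtain ⟨a, ha⟩ := (Submodule.mem_span_range_iff_exists_fun ℝ).1
    ((normalSubspace c x).starProjection_apply_mem (gradient f x))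
  refine ⟨WithLp.toLp 2 a, ?_⟩
  rw [gradLagrangian_eq hf hc]
  simp only [ha]
  exact (normalSubspace c x).sub_starProjection_mem_orthogonal (gradient f x)

theorem isMultiplier_iff_eq (hf : DifferentiableAt ℝ f x) (hc : ∀ i, DifferentiableAt ℝ (c i) x)
    (hx : LICQAt c x) {ν₀ : EuclideanSpace ℝ (Fin m)}
    (h₀ : gradLagrangian f c x ν₀ ∈ tangentSubspace c x) (ν : EuclideanSpace ℝ (Fin m)) :
    IsMultiplier f c x ν ↔ ν = ν₀ := by
  refine ⟨fun h ↦ ?_, ?_⟩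
  · have h1 : ‖gradLagrangian f c x ν‖ ≤ ‖gradLagrangian f c x ν₀‖ := h (Set.mem_univ ν₀)
    have h2 := norm_gradLagrangian_sq hf hc h₀ ν
    have h3 : ‖∑ i, (ν₀ - ν) i • gradient (c i) x‖ ^ 2 = 0 :=
      le_antisymm (by nlinarith [norm_nonneg (gradLagrangian f c x ν)]) (sq_nonneg _)
    have h4 := Fintype.linearIndependent_iff.1 hx _ (norm_eq_zero.1 (pow_eq_zero_iff two_ne_zero |>.1 h3))
    ext i
    have := h4 i
    rw [PiLp.sub_apply] at this
    linarith
  · rintro rfl ν' -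
    have h := norm_gradLagrangian_sq hf hc h₀ ν'
    exact le_of_sq_le_sq (h ▸ le_add_of_nonneg_right (sq_nonneg _)) (norm_nonneg _)

theorem existsUnique_isMultiplier (hf : DifferentiableAt ℝ f x)
    (hc : ∀ i, DifferentiableAt ℝ (c i) x) (hx : LICQAt c x) : ∃! ν, IsMultiplier f c x ν := by
  obtain ⟨ν₀, h₀⟩ := exists_gradLagrangian_mem_tangentSubspace hf hc
  simp only [isMultiplier_iff_eq hf hc hx h₀, existsUnique_eq]

theorem IsMultiplier.gradLagrangian_mem_tangentSubspace (hf : DifferentiableAt ℝ f x)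
    (hc : ∀ i, DifferentiableAt ℝ (c i) x) (hx : LICQAt c x) {ν : EuclideanSpace ℝ (Fin m)}
    (h : IsMultiplier f c x ν) : gradLagrangian f c x ν ∈ tangentSubspace c x := by
  obtain ⟨ν₀, h₀⟩ := exists_gradLagrangian_mem_tangentSubspace hf hc
  rwa [(isMultiplier_iff_eq hf hc hx h₀ ν).1 h]

theorem finrank_tangentSubspace (hx : LICQAt c x) :
    Module.finrank ℝ (tangentSubspace c x) = n - m := by
  have h1 := (normalSubspace c x).finrank_add_finrank_orthogonal
  have h2 : Module.finrank ℝ (normalSubspace c x) = m := by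
    rw [normalSubspace, finrank_span_eq_card hx, Fintype.card_fin]
  rw [h2, finrank_euclideanSpace_fin] at h1
  rw [tangentSubspace]
  omega

theorem differentiableAt_gradLagrangian (hf : Differentiable ℝ f) (hc : ∀ i, Differentiable ℝ (c i))
    (hf' : DifferentiableAt ℝ (fderiv ℝ f) x) (hc' : ∀ i, DifferentiableAt ℝ (fderiv ℝ (c i)) x)
    (ν : EuclideanSpace ℝ (Fin m)) : DifferentiableAt ℝ (fun y ↦ gradLagrangian f c y ν) x := by
  have : (fun y ↦ gradLagrangian f c y ν) =
      fun y ↦ gradient f y - ∑ i, ν i • gradient (c i) y :=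
    funext fun y ↦ gradLagrangian_eq (hf y) (fun i ↦ hc i y) ν
  rw [this]
  exact (differentiableAt_gradient hf').sub
    (DifferentiableAt.fun_sum fun i _ ↦ (differentiableAt_gradient (hc' i)).fun_const_smul (ν i))

/-- The Lagrangian gradient and the gradient of `f` differ by a normal vector. -/
theorem inner_gradLagrangian_of_mem_tangentSubspace (hf : DifferentiableAt ℝ f x)
    (hc : ∀ i, DifferentiableAt ℝ (c i) x) (ν : EuclideanSpace ℝ (Fin m))
    {v : EuclideanSpace ℝ (Fin n)} (hv : v ∈ tangentSubspace c x) :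
    ⟪gradLagrangian f c x ν, v⟫ = fderiv ℝ f x v := by
  rw [gradLagrangian_eq hf hc, inner_sub_left, sum_inner, inner_gradient_left]
  simp [inner_smul_left, inner_gradient_left, mem_tangentSubspace.1 hv]

end Multipliers

/-! ### Slice charts of a regular level set -/

section SliceCharts

open Set Topology

variable {V E F : Type*} [NormedAddCommGroup V] [NormedSpace ℝ V] [NormedAddCommGroup E]
  [NormedSpace ℝ E] [NormedAddCommGroup F] [NormedSpace ℝ F] {n : ℕ∞ω} {S : Set V}

/-- `Φ : V → E × F` is a `C^n` slice chart for `S`: a `C^n` diffeomorphism between open sets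
which carries `S` to the slice `E × {0}`. -/
structure IsSliceChart (n : ℕ∞ω) (S : Set V) (Φ : OpenPartialHomeomorph V (E × F)) : Prop where
  contDiffOn : ContDiffOn ℝ n Φ Φ.source
  contDiffOn_symm : ContDiffOn ℝ n Φ.symm Φ.target
  mem_iff : ∀ y ∈ Φ.source, y ∈ S ↔ (Φ y).2 = 0

namespace IsSliceChart

variable {Φ Φ' : OpenPartialHomeomorph V (E × F)}

theorem symm_mem (h : IsSliceChart n S Φ) {u : E} (hu : (u, (0 : F)) ∈ Φ.target) :
    Φ.symm (u, 0) ∈ S :=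
  (h.mem_iff _ (Φ.map_target hu)).2 (by rw [Φ.right_inv hu])

theorem apply_eq (h : IsSliceChart n S Φ) {y : V} (hy : y ∈ Φ.source) (hyS : y ∈ S) :
    ((Φ y).1, (0 : F)) = Φ y :=
  Prod.ext rfl ((h.mem_iff y hy).1 hyS).symm

open Classical in
/-- The chart of `S` given by the first component of a slice chart. The point `x` of `S` only serves
to define the inverse outside of its domain. -/
def chart (h : IsSliceChart n S Φ) (x : S) : OpenPartialHomeomorph S E where
  toFun y := (Φ y).1
  invFun u := if hu : Φ.symm (u, 0) ∈ S then ⟨Φ.symm (u, 0), hu⟩ else x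
  source := Subtype.val ⁻¹' Φ.source
  target := {u | (u, (0 : F)) ∈ Φ.target}
  map_source' y hy := by
    rw [mem_ofPred_eq, h.apply_eq hy y.2]
    exact Φ.map_source hy
  map_target' u hu := by
    rw [dif_pos (h.symm_mem hu)]
    exact Φ.map_target hu
  left_inv' y hy := by
    have : Φ.symm ((Φ y).1, 0) = y := by rw [h.apply_eq hy y.2, Φ.left_inv hy]
    simp only [this, Subtype.coe_prop, dite_true]
  right_inv' u hu := by
    simp only [h.symm_mem hu, dite_true]
    rw [Φ.right_inv hu]
  open_source := Φ.open_source.preimage continuous_subtype_val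
  open_target := Φ.open_target.preimage (by fun_prop)
  continuousOn_toFun := continuous_fst.comp_continuousOn
    (Φ.continuousOn.comp continuous_subtype_val.continuousOn fun _ hy ↦ hy)
  continuousOn_invFun := by
    rw [Topology.IsInducing.subtypeVal.continuousOn_iff]
    refine (Φ.continuousOn_symm.comp (f := fun u : E ↦ (u, (0 : F)))
      (by fun_prop) fun _ hu ↦ hu).congr fun u hu ↦ ?_
    simp [h.symm_mem hu]

theorem chart_apply (h : IsSliceChart n S Φ) (x y : S) : h.chart x y = (Φ y).1 := rfl

theorem coe_chart_symm (h : IsSliceChart n S Φ) (x : S) {u : E} (hu : (u, (0 : F)) ∈ Φ.target) :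
    ((h.chart x).symm u : V) = Φ.symm (u, 0) := by
  classical
  exact congrArg Subtype.val (dif_pos (h.symm_mem hu))

theorem contDiffOn_chart_symm_trans (h : IsSliceChart n S Φ) (h' : IsSliceChart n S Φ') (x x' : S) :
    ContDiffOn ℝ n (h'.chart x' ∘ (h.chart x).symm) ((h.chart x).symm ≫ₕ h'.chart x').source := by
  have hs : ((h.chart x).symm ≫ₕ h'.chart x').source ⊆
      {u | (u, (0 : F)) ∈ Φ.target ∧ Φ.symm (u, 0) ∈ Φ'.source} := by
    intro u hu
    rw [OpenPartialHomeomorph.trans_source] at hu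
    have h1 : (u, (0 : F)) ∈ Φ.target := hu.1
    have h2 : ((h.chart x).symm u : V) ∈ Φ'.source := hu.2
    rw [h.coe_chart_symm x h1] at h2
    exact ⟨h1, h2⟩
  have hin : ContDiff ℝ n (fun u : E ↦ (u, (0 : F))) := contDiff_id.prodMk contDiff_const
  refine (contDiff_fst.comp_contDiffOn (h'.contDiffOn.comp
    (h.contDiffOn_symm.comp hin.contDiffOn fun u hu ↦ (hs hu).1) fun u hu ↦ (hs hu).2)).congr
      fun u hu ↦ ?_
  rw [Function.comp_apply, chart_apply, h.coe_chart_symm x (hs hu).1]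
  rfl

end IsSliceChart

/-- The charted space structure on `S` given by a family of slice charts covering `S`. -/
@[reducible] def chartedSpaceOfSliceCharts {Φ : S → OpenPartialHomeomorph V (E × F)}
    (h : ∀ x, IsSliceChart n S (Φ x)) (hx : ∀ x : S, (x : V) ∈ (Φ x).source) : ChartedSpace E S where
  atlas := range fun x ↦ (h x).chart x
  chartAt x := (h x).chart x
  mem_chart_source x := hx x
  chart_mem_atlas x := mem_range_self x

theorem isManifold_chartedSpaceOfSliceCharts {Φ : S → OpenPartialHomeomorph V (E × F)}
    (h : ∀ x, IsSliceChart n S (Φ x)) (hx : ∀ x : S, (x : V) ∈ (Φ x).source) :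
    letI := chartedSpaceOfSliceCharts h hx
    IsManifold 𝓘(ℝ, E) n S := by
  let _ := chartedSpaceOfSliceCharts h hx
  refine isManifold_of_contDiffOn _ _ _ ?_
  rintro _ _ ⟨x, rfl⟩ ⟨x', rfl⟩
  simpa using (h x).contDiffOn_chart_symm_trans (h x') x x'

theorem isSmoothEmbedding_chartedSpaceOfSliceCharts {Φ : S → OpenPartialHomeomorph V (E × F)}
    (h : ∀ x, IsSliceChart n S (Φ x)) (hx : ∀ x : S, (x : V) ∈ (Φ x).source)
    (T : S → (E × F) ≃L[ℝ] V) :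
    letI := chartedSpaceOfSliceCharts h hx
    Manifold.IsSmoothEmbedding 𝓘(ℝ, E) 𝓘(ℝ, V) n (Subtype.val : S → V) := by
  let _ := chartedSpaceOfSliceCharts h hx
  have := isManifold_chartedSpaceOfSliceCharts h hx
  refine ⟨Manifold.IsImmersionOfComplement.isImmersion (F := F) fun x ↦ ?_, .subtypeVal⟩
  refine Manifold.IsImmersionAtOfComplement.mk_of_continuousAt continuous_subtype_val.continuousAt
    (T x) (chartAt E x) ((Φ x).trans (T x).toHomeomorph.toOpenPartialHomeomorph)
    (mem_chart_source E x) (by simpa using hx x) (IsManifold.chart_mem_maximalAtlas x) ?_ ?_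
  · refine StructureGroupoid.mem_maximalAtlas_of_mem_groupoid _ ?_
    refine (contDiffGroupoid n 𝓘(ℝ, V)).mem_of_eqOnSource ?_ (Setoid.refl _)
    rw [contDiffGroupoid, mem_groupoid_of_pregroupoid]
    constructor
    · simpa [contDiffPregroupoid] using (T x).contDiff.comp_contDiffOn (h x).contDiffOn
    · have := (h x).contDiffOn_symm.comp (T x).symm.contDiff.contDiffOn
        (s := (T x).symm ⁻¹' (Φ x).target) fun _ hy ↦ hy
      simpa [contDiffPregroupoid] using this
  · intro u hu
    have hu' : (u, (0 : F)) ∈ (Φ x).target := by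
      have : u ∈ (chartAt E x).target := by simpa using hu
      exact this
    have h1 : (((chartAt E x).symm u : S) : V) = (Φ x).symm (u, 0) := (h x).coe_chart_symm x hu'
    simp [h1, (Φ x).right_inv hu']

/-- Regular level sets have slice charts: complement the derivative of `C` by a linear map to the
model space `E` and apply the inverse function theorem. -/
theorem exists_isSliceChart [CompleteSpace V] {k : ℕ∞} (hk : 1 ≤ k) {C : V → F}
    (hC : ContDiff ℝ k C) (hS : ∀ y, y ∈ S ↔ C y = 0) {x : V} (T : V ≃L[ℝ] E × F)
    (hT : ∀ v, (T v).2 = fderiv ℝ C x v) :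
    ∃ Φ : OpenPartialHomeomorph V (E × F), IsSliceChart k S Φ ∧ x ∈ Φ.source := by
  have hk' : (1 : ℕ∞ω) ≤ k := WithTop.coe_le_coe.2 hk
  have hk0 : (k : ℕ∞ω) ≠ 0 := (zero_lt_one.trans_le hk').ne'
  set g : V → E × F := fun y ↦ ((T y).1, C y) with hg
  have hgk : ContDiff ℝ k g := (contDiff_fst.comp T.contDiff).prodMk hC
  have hgx : HasFDerivAt g (T : V →L[ℝ] E × F) x := by
    have h1 : HasFDerivAt g ((ContinuousLinearMap.fst ℝ E F ∘L (T : V →L[ℝ] E × F)).prod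
        (fderiv ℝ C x)) x :=
      ((ContinuousLinearMap.fst ℝ E F ∘L (T : V →L[ℝ] E × F)).hasFDerivAt).prodMk
        (hC.differentiable hk0 x).hasFDerivAt
    convert h1 using 1
    ext v
    · rfl
    · exact hT v
  set Ψ := hgk.contDiffAt.toOpenPartialHomeomorph g hgx hk0 with hΨ
  -- restrict to the open set where the derivative is invertible, so that the inverse is `C^k` there
  have hopen : IsOpen {y | fderiv ℝ g y ∈ range ((↑) : (V ≃L[ℝ] E × F) → V →L[ℝ] E × F)} :=
    ContinuousLinearEquiv.isOpen.preimage (hgk.continuous_fderiv hk0)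
  refine ⟨Ψ.restrOpen _ hopen, ⟨?_, ?_, ?_⟩, ?_⟩
  · exact hgk.contDiffOn
  · intro z hz
    refine ContDiffAt.contDiffWithinAt ?_
    have hz' := (Ψ.restrOpen _ hopen).map_target hz
    obtain ⟨A, hA⟩ := hz'.2
    refine (Ψ.restrOpen _ hopen).contDiffAt_symm (f₀' := A) hz ?_ hgk.contDiffAt
    rw [hA]
    exact (hgk.differentiable hk0 _).hasFDerivAt
  · intro y _
    exact hS y
  · exact ⟨hgk.contDiffAt.mem_toOpenPartialHomeomorph_source hgx hk0, T, hgx.fderiv.symm⟩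

/-- A surjective linear map is, up to a change of coordinates, the second projection. -/
theorem ContinuousLinearMap.exists_equiv_prod_snd [FiniteDimensional ℝ V] [FiniteDimensional ℝ E]
    [FiniteDimensional ℝ F] (A : V →L[ℝ] F) (hA : Function.Surjective A)
    (hdim : Module.finrank ℝ V = Module.finrank ℝ E + Module.finrank ℝ F) :
    ∃ T : V ≃L[ℝ] E × F, ∀ v, (T v).2 = A v := by
  have hker : Module.finrank ℝ (A : V →ₗ[ℝ] F).ker = Module.finrank ℝ E := by
    have h1 := (A : V →ₗ[ℝ] F).finrank_range_add_finrank_ker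
    rw [LinearMap.range_eq_top.2 hA, finrank_top] at h1
    omega
  obtain ⟨P, hP⟩ := (A : V →ₗ[ℝ] F).ker.subtype.exists_leftInverse_of_injective
    (LinearMap.ker_eq_bot.2 Subtype.val_injective)
  let e := LinearEquiv.ofFinrankEq _ E hker
  let B : V →ₗ[ℝ] E × F := (e.toLinearMap ∘ₗ P).prod A
  have hB : Function.Injective B := by
    refine (injective_iff_map_eq_zero _).2 fun v hv ↦ ?_
    have h1 : e (P v) = 0 := congrArg Prod.fst hv
    have h2 : A v = 0 := congrArg Prod.snd hv
    have h3 : P v = ⟨v, h2⟩ := LinearMap.congr_fun hP ⟨v, h2⟩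
    rw [h3, LinearEquiv.map_eq_zero_iff] at h1
    exact congrArg Subtype.val h1
  exact ⟨(LinearEquiv.ofInjectiveOfFinrankEq B hB (by simpa using hdim)).toContinuousLinearEquiv,
    fun v ↦ rfl⟩

end SliceCharts

/-! ### The induced metric -/

section InducedMetric

open Set Topology

variable {V : Type*} [NormedAddCommGroup V] [InnerProductSpace ℝ V]
  {E : Type*} [NormedAddCommGroup E] [NormedSpace ℝ E] [FiniteDimensional ℝ E]
  {M : Type*} [TopologicalSpace M] [ChartedSpace E M] [IsManifold 𝓘(ℝ, E) 2 M] {g : M → V} {x : M}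

/-- The metric induced by `g : M → V`, as a bilinear form on the tangent space. -/
def inducedForm (g : M → V) (x : M) : TangentSpace 𝓘(ℝ, E) x →L[ℝ] TangentSpace 𝓘(ℝ, E) x →L[ℝ] ℝ :=
  gramForm (E := E) (mvfderiv 𝓘(ℝ, E) g x)

/-- The unit ball of an induced metric is bounded, that is, the metric induces the given topology. -/
theorem isVonNBounded_gramForm {A : E →L[ℝ] V} (hA : Function.Injective A) :
    Bornology.IsVonNBounded ℝ {v : E | gramForm A v v < 1} := by
  obtain ⟨K, -, hK⟩ := (A : E →ₗ[ℝ] V).exists_antilipschitzWith (LinearMap.ker_eq_bot.2 hA)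
  rw [NormedSpace.isVonNBounded_iff]
  refine (Metric.isBounded_closedBall (x := (0 : E)) (r := K)).subset fun v hv ↦ ?_
  rw [mem_closedBall_zero_iff]
  have h1 : ‖A v‖ ≤ 1 := by
    have : ‖A v‖ ^ 2 < 1 := by rw [← real_inner_self_eq_norm_sq]; exact hv
    nlinarith [norm_nonneg (A v)]
  have h2 := hK.le_mul_dist v 0
  simp only [dist_zero_right, map_zero, ContinuousLinearMap.coe_coe] at h2
  exact h2.trans (mul_le_of_le_one_right K.2 h1)

omit [FiniteDimensional ℝ E] in
theorem contMDiff_inducedForm {k : ℕ∞} (hk : 1 ≤ k) [IsManifold 𝓘(ℝ, E) k M]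
    (hg : ContMDiff 𝓘(ℝ, E) 𝓘(ℝ, V) k g) :
    ContMDiff 𝓘(ℝ, E) (𝓘(ℝ, E).prod 𝓘(ℝ, E →L[ℝ] E →L[ℝ] ℝ)) ((k - 1 : ℕ∞) : ℕ∞ω)
      (fun x ↦ Bundle.TotalSpace.mk' (E →L[ℝ] E →L[ℝ] ℝ)
        (E := fun x : M ↦ TangentSpace 𝓘(ℝ, E) x →L[ℝ] TangentSpace 𝓘(ℝ, E) x →L[ℝ] ℝ)
        x (inducedForm g x)) := by
  intro x
  rw [Bundle.contMDiffAt_section]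
  have h1 : ContMDiffAt 𝓘(ℝ, E) 𝓘(ℝ, E →L[ℝ] E →L[ℝ] ℝ) ((k - 1 : ℕ∞) : ℕ∞ω)
      (fun y ↦ gramForm (fderiv ℝ (g ∘ (extChartAt 𝓘(ℝ, E) x).symm) (extChartAt 𝓘(ℝ, E) x y))) x := by
    have hφ : ContMDiffAt 𝓘(ℝ, E) 𝓘(ℝ, E) ((k - 1 : ℕ∞) : ℕ∞ω) (extChartAt 𝓘(ℝ, E) x) x :=
      (contMDiffAt_extChartAt (n := k)).of_le (WithTop.coe_le_coe.2 tsub_le_self)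
    have hd : ContDiffAt ℝ ((k - 1 : ℕ∞) : ℕ∞ω)
        (fderiv ℝ (g ∘ (extChartAt 𝓘(ℝ, E) x).symm)) (extChartAt 𝓘(ℝ, E) x x) :=
      ((hg.contDiffOn_comp_extChartAt_symm x).contDiffAt
        (extChartAt_target_mem_nhds x)).fderiv_right
          (WithTop.coe_le_coe.2 (tsub_add_cancel_of_le hk).le)
    exact (contDiff_gramForm.contDiffAt.comp _ hd).contMDiffAt.comp x hφ
  refine h1.congr_of_eventuallyEq ?_
  filter_upwards [extChartAt_source_mem_nhds (I := 𝓘(ℝ, E)) x] with y hy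
  ext v w
  have hy' : y ∈ (chartAt E x).source := by simpa using hy
  have hbase : y ∈ (trivializationAt (E →L[ℝ] ℝ)
      (fun x : M ↦ TangentSpace 𝓘(ℝ, E) x →L[ℝ] Bundle.Trivial M ℝ x) x).baseSet := by
    simpa [hom_trivializationAt_baseSet] using hy'
  have hD (v : E) : fderiv ℝ (g ∘ (extChartAt 𝓘(ℝ, E) x).symm) (extChartAt 𝓘(ℝ, E) x y) v =
      mvfderiv 𝓘(ℝ, E) g y ((trivializationAt E (TangentSpace 𝓘(ℝ, E)) x).symmL ℝ y v) := by
    have hu := (extChartAt 𝓘(ℝ, E) x).map_source hy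
    rw [TangentBundle.symmL_trivializationAt hy',
      fderiv_comp_extChartAt_symm hu (hg.mdifferentiable (zero_lt_one.trans_le
        (WithTop.coe_le_coe.2 hk : (1 : ℕ∞ω) ≤ k)).ne' _)]
    -- all derivatives have type `E →L[ℝ] V`, so the base point can be rewritten by congruence
    let D : M → E →L[ℝ] V := fun z ↦ mvfderiv 𝓘(ℝ, E) g z
    exact congrArg (fun A : E →L[ℝ] V ↦ A (mfderivWithin 𝓘(ℝ, E) 𝓘(ℝ, E) (extChartAt 𝓘(ℝ, E) x).symm
      (range 𝓘(ℝ, E)) (extChartAt 𝓘(ℝ, E) x y) v))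
      (congrArg D ((extChartAt 𝓘(ℝ, E) x).left_inv hy))
  simp only [hom_trivializationAt_apply, ContinuousLinearMap.inCoordinates,
    ContinuousLinearMap.comp_apply, gramForm_apply, hD]
  rw [Bundle.Trivialization.continuousLinearMapAt_apply,
    Bundle.Trivialization.coe_linearMapAt_of_mem _ hbase]
  simp only [hom_trivializationAt_apply, ContinuousLinearMap.inCoordinates,
    ContinuousLinearMap.comp_apply]
  exact congrArg (fun A : ℝ →L[ℝ] ℝ ↦ A _)
    (Bundle.Trivial.continuousLinearMapAt_trivialization ℝ M ℝ y)

end InducedMetric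

/-! ### Regular level sets as Riemannian submanifolds -/

section RegularLevelSet

open Set Topology

theorem injective_mvfderiv_of_comp_eq_extChartAt {V : Type*} [NormedAddCommGroup V]
    [NormedSpace ℝ V] {E : Type*} [NormedAddCommGroup E] [NormedSpace ℝ E] {M : Type*}
    [TopologicalSpace M] [ChartedSpace E M] [IsManifold 𝓘(ℝ, E) 1 M] {g : M → V} {x : M}
    {r : V → E} (hr : DifferentiableAt ℝ r (g x)) (hg : MDiffAt g x)
    (h : r ∘ g = extChartAt 𝓘(ℝ, E) x) :
    Function.Injective (mvfderiv 𝓘(ℝ, E) g x) := by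
  have h1 := mfderiv_comp x hr.mdifferentiableAt hg
  rw [h] at h1
  have h2 := (isInvertible_mfderiv_extChartAt (I := 𝓘(ℝ, E)) (mem_extChartAt_source x)).injective
  rw [h1] at h2
  exact Function.Injective.of_comp h2

variable {V : Type*} [NormedAddCommGroup V] [InnerProductSpace ℝ V]
  {E : Type*} [NormedAddCommGroup E] [NormedSpace ℝ E] [FiniteDimensional ℝ E]

/-- The metric on `S` induced from `V` by the inclusion. -/
@[reducible] def inducedMetric {k : ℕ∞} (hk : 2 ≤ k) {S : Set V} [ChartedSpace E S]
    [IsManifold 𝓘(ℝ, E) 2 S] [IsManifold 𝓘(ℝ, E) k S]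
    (hS : ContMDiff 𝓘(ℝ, E) 𝓘(ℝ, V) k (Subtype.val : S → V))
    (hinj : ∀ x : S, Function.Injective (inclusionDeriv (E := E) x)) :
    Bundle.ContMDiffRiemannianMetric 𝓘(ℝ, E) ((k - 1 : ℕ∞) : ℕ∞ω) E
      (fun x : S ↦ TangentSpace 𝓘(ℝ, E) x) where
  inner x := inducedForm Subtype.val x
  symm _ _ _ := real_inner_comm _ _
  pos x _ hv := real_inner_self_pos.2 fun h ↦ hv (hinj x (h.trans (map_zero _).symm))
  isVonNBounded x := isVonNBounded_gramForm (E := E) (hinj x)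
  contMDiff := contMDiff_inducedForm (one_le_two.trans hk) hS

theorem isEmbeddedRiemannianSubmanifold_inducedMetric {k : ℕ∞} (hk : 2 ≤ k) {S : Set V}
    [ChartedSpace E S] [IsManifold 𝓘(ℝ, E) 2 S] [IsManifold 𝓘(ℝ, E) k S]
    (hS : Manifold.IsSmoothEmbedding 𝓘(ℝ, E) 𝓘(ℝ, V) k (Subtype.val : S → V))
    (hinj : ∀ x : S, Function.Injective (inclusionDeriv (E := E) x)) :
    letI : Bundle.RiemannianBundle (fun x : S ↦ TangentSpace 𝓘(ℝ, E) x) :=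
      ⟨(inducedMetric hk hS.contMDiff hinj).toRiemannianMetric⟩
    IsEmbeddedRiemannianSubmanifold E k S := by
  let _ : Bundle.RiemannianBundle (fun x : S ↦ TangentSpace 𝓘(ℝ, E) x) :=
    ⟨(inducedMetric hk hS.contMDiff hinj).toRiemannianMetric⟩
  exact ⟨‹_›, hS, inferInstance, fun x u v ↦ rfl⟩

/-- A regular level set of a `C^k` map is a `C^k` embedded Riemannian submanifold. -/
theorem exists_isEmbeddedRiemannianSubmanifold [FiniteDimensional ℝ V] {F : Type*}
    [NormedAddCommGroup F] [NormedSpace ℝ F] [FiniteDimensional ℝ F] {k : ℕ∞} (hk : 2 ≤ k)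
    {S : Set V} {C : V → F} (hC : ContDiff ℝ k C) (hS : ∀ y, y ∈ S ↔ C y = 0)
    (hsurj : ∀ x ∈ S, Function.Surjective (fderiv ℝ C x))
    (hdim : S.Nonempty → Module.finrank ℝ V = Module.finrank ℝ E + Module.finrank ℝ F) :
    ∃ (_ : ChartedSpace E S) (_ : IsManifold 𝓘(ℝ, E) 2 S)
      (_ : Bundle.RiemannianBundle (fun x : S ↦ TangentSpace 𝓘(ℝ, E) x)),
      IsEmbeddedRiemannianSubmanifold E k S := by
  have : CompleteSpace V := FiniteDimensional.complete ℝ V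
  have hk' : (2 : ℕ∞ω) ≤ k := WithTop.coe_le_coe.2 hk
  choose T hT using fun x : S ↦ (fderiv ℝ C x).exists_equiv_prod_snd (E := E) (hsurj x x.2)
    (hdim ⟨x, x.2⟩)
  choose Φ hΦ hxΦ using fun x : S ↦ exists_isSliceChart (one_le_two.trans hk) hC hS (T x) (hT x)
  let _ := chartedSpaceOfSliceCharts hΦ hxΦ
  have hM : IsManifold 𝓘(ℝ, E) k S := isManifold_chartedSpaceOfSliceCharts hΦ hxΦ
  have hM2 : IsManifold 𝓘(ℝ, E) 2 S := IsManifold.of_le hk'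
  have hemb := isSmoothEmbedding_chartedSpaceOfSliceCharts hΦ hxΦ fun x ↦ (T x).symm
  have hinj : ∀ x : S, Function.Injective (inclusionDeriv (E := E) x) := fun x ↦
    injective_mvfderiv_of_comp_eq_extChartAt (r := fun y ↦ (Φ x y).1)
      (((hΦ x).contDiffOn.differentiableOn (two_pos.trans_le hk').ne' |>.differentiableAt
        ((Φ x).open_source.mem_nhds (hxΦ x))).fst)
      (hemb.contMDiff.mdifferentiable (two_pos.trans_le hk').ne' x) rfl
  exact ⟨inferInstance, hM2, _, isEmbeddedRiemannianSubmanifold_inducedMetric hk hemb hinj⟩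

end RegularLevelSet

/-! ### Riemannian geometry of the feasible set -/

section ConstrainedProblem

variable {n m : ℕ} {c : Fin m → EuclideanSpace ℝ (Fin n) → ℝ} {x : EuclideanSpace ℝ (Fin n)}

theorem LICQAt.le (hx : LICQAt c x) : m ≤ n := by
  simpa using LinearIndependent.fintype_card_le_finrank hx

/-- The kernel of the derivative is the tangent subspace, whose dimension is `n - m`. -/
theorem LICQAt.surjective_fderiv (hc : ∀ i, DifferentiableAt ℝ (c i) x) (hx : LICQAt c x) :
    Function.Surjective (fderiv ℝ (fun y ↦ WithLp.toLp 2 fun i ↦ c i y) x) := by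
  have hC : HasFDerivAt (fun y ↦ WithLp.toLp 2 fun i ↦ c i y)
      (((PiLp.continuousLinearEquiv 2 ℝ fun _ : Fin m ↦ ℝ).symm :
        (Fin m → ℝ) →L[ℝ] EuclideanSpace ℝ (Fin m)) ∘L
          ContinuousLinearMap.pi fun i ↦ fderiv ℝ (c i) x) x :=
    (PiLp.continuousLinearEquiv 2 ℝ fun _ : Fin m ↦ ℝ).symm.hasFDerivAt.comp x
      (hasFDerivAt_pi.2 fun i ↦ (hc i).hasFDerivAt)
  have hker : (fderiv ℝ (fun y ↦ WithLp.toLp 2 fun i ↦ c i y) x :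
      EuclideanSpace ℝ (Fin n) →ₗ[ℝ] EuclideanSpace ℝ (Fin m)).ker = tangentSubspace c x := by
    ext v
    rw [hC.fderiv, mem_tangentSubspace, LinearMap.mem_ker]
    exact ⟨fun h i ↦ congrArg (fun w : EuclideanSpace ℝ (Fin m) ↦ w i) h, fun h ↦ by ext i; exact h i⟩
  have h1 := LinearMap.finrank_range_add_finrank_ker
    (fderiv ℝ (fun y ↦ WithLp.toLp 2 fun i ↦ c i y) x :
      EuclideanSpace ℝ (Fin n) →ₗ[ℝ] EuclideanSpace ℝ (Fin m))
  rw [hker, finrank_tangentSubspace hx, finrank_euclideanSpace_fin] at h1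
  refine LinearMap.range_eq_top.1 (Submodule.eq_top_of_finrank_eq ?_)
  rw [finrank_euclideanSpace_fin]
  have := hx.le
  omega

theorem exists_isEmbeddedRiemannianSubmanifold_feasibleSet {k : ℕ∞} (hk : 2 ≤ k)
    (hc : ∀ i, ContDiff ℝ k (c i)) (hLICQ : ∀ x ∈ feasibleSet c, LICQAt c x) :
    ∃ (_ : ChartedSpace (EuclideanSpace ℝ (Fin (n - m))) (feasibleSet c))
        (_ : IsManifold (𝓡 (n - m)) 2 (feasibleSet c))
        (_ : Bundle.RiemannianBundle (fun x : feasibleSet c ↦ TangentSpace (𝓡 (n - m)) x)),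
        IsEmbeddedRiemannianSubmanifold (EuclideanSpace ℝ (Fin (n - m))) k (feasibleSet c) := by
  have hk' : (2 : ℕ∞ω) ≤ k := WithTop.coe_le_coe.2 hk
  refine exists_isEmbeddedRiemannianSubmanifold hk
    (C := fun y ↦ WithLp.toLp 2 fun i ↦ c i y) (contDiff_euclidean.2 hc) (fun y ↦ ?_)
    (fun x hx ↦ (hLICQ x hx).surjective_fderiv fun i ↦
      (hc i).differentiable (two_pos.trans_le hk').ne' x) ?_
  · exact ⟨fun h ↦ by ext i; exact h i,
      fun h i ↦ congrArg (fun w : EuclideanSpace ℝ (Fin m) ↦ w i) h⟩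
  · rintro ⟨x, hx⟩
    have := (hLICQ x hx).le
    simp only [finrank_euclideanSpace_fin]
    omega

variable {k : ℕ∞} [ChartedSpace (EuclideanSpace ℝ (Fin (n - m))) (feasibleSet c)]
  [IsManifold (𝓡 (n - m)) 2 (feasibleSet c)]
  [Bundle.RiemannianBundle (fun x : feasibleSet c ↦ TangentSpace (𝓡 (n - m)) x)]

namespace IsEmbeddedRiemannianSubmanifold

theorem range_inclusionDeriv
    (h : IsEmbeddedRiemannianSubmanifold (EuclideanSpace ℝ (Fin (n - m))) k (feasibleSet c))
    (hk : 2 ≤ k) (hc : ∀ i, Differentiable ℝ (c i)) (x : feasibleSet c) (hx : LICQAt c x) :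
    (inclusionDeriv (E := EuclideanSpace ℝ (Fin (n - m))) x).range = tangentSubspace c x := by
  have hι := (h.contMDiff_val hk).mdifferentiable two_ne_zero x
  refine Submodule.eq_of_le_of_finrank_eq ?_ ?_
  · rintro _ ⟨v, rfl⟩
    refine mem_tangentSubspace.2 fun i ↦ ?_
    refine (mvfderiv_comp_val (hc i x) hι v).symm.trans ?_
    have : (fun y : feasibleSet c ↦ c i y) = fun _ ↦ 0 := funext fun y ↦ y.2 i
    rw [this, mvfderiv_const]
    rfl
  · rw [finrank_tangentSubspace hx]
    exact (LinearMap.finrank_range_of_inj (h.inclusionDeriv_injective x)).trans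
      (finrank_euclideanSpace_fin (𝕜 := ℝ))

theorem inclusionDeriv_riemannianGradient {f : EuclideanSpace ℝ (Fin n) → ℝ}
    (h : IsEmbeddedRiemannianSubmanifold (EuclideanSpace ℝ (Fin (n - m))) k (feasibleSet c))
    (hk : 2 ≤ k) (hf : Differentiable ℝ f) (hc : ∀ i, Differentiable ℝ (c i)) (x : feasibleSet c)
    (hx : LICQAt c x) {ν : EuclideanSpace ℝ (Fin m)} (hν : IsMultiplier f c x ν) :
    inclusionDeriv x (riemannianGradient (𝓡 (n - m)) (fun y : feasibleSet c ↦ f y) x) =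
      gradLagrangian f c x ν := by
  have hι := (h.contMDiff_val hk).mdifferentiable two_ne_zero x
  have hrange := h.range_inclusionDeriv hk hc x hx
  have hG := hν.gradLagrangian_mem_tangentSubspace (hf x) (fun i ↦ hc i x) hx
  rw [← hrange] at hG
  obtain ⟨v, hv⟩ := hG
  rw [← hv]
  refine congrArg (inclusionDeriv x) (ext_inner_right ℝ fun w ↦ ?_)
  have hw : inclusionDeriv x w ∈ tangentSubspace c x := hrange ▸ ⟨w, rfl⟩
  rw [inner_riemannianGradient, mvfderiv_comp_val (hf x) hι, h.inner_eq]
  refine Eq.trans ?_ (congrArg (fun u ↦ ⟪u, inclusionDeriv x w⟫) hv.symm)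
  exact (inner_gradLagrangian_of_mem_tangentSubspace (hf x) (fun i ↦ hc i x) ν hw).symm

/-- Along `S` the Lagrangian gradient with the multiplier frozen at its value at `x` has the same
tangential part as `grad f`, and it is tangent at `x`; so its derivative represents `∇ grad f`. -/
theorem riemannianHessian_eq {f : EuclideanSpace ℝ (Fin n) → ℝ}
    (h : IsEmbeddedRiemannianSubmanifold (EuclideanSpace ℝ (Fin (n - m))) k (feasibleSet c))
    (hk : 2 ≤ k) (hf : Differentiable ℝ f) (hf' : Differentiable ℝ (fderiv ℝ f))
    (hc : ∀ i, ContDiff ℝ 2 (c i)) (hLICQ : ∀ x ∈ feasibleSet c, LICQAt c x)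
    {cov : CovariantDerivative (𝓡 (n - m)) (EuclideanSpace ℝ (Fin (n - m)))
      (fun x : feasibleSet c ↦ TangentSpace (𝓡 (n - m)) x)}
    (hcov : IsLeviCivita cov) (x : feasibleSet c) {ν : EuclideanSpace ℝ (Fin m)}
    (hν : IsMultiplier f c x ν) (ξ η : TangentSpace (𝓡 (n - m)) x) :
    riemannianHessian cov (fun y : feasibleSet c ↦ f y) x ξ η =
      ⟪hessLagrangian f c x ν (inclusionDeriv x ξ), inclusionDeriv x η⟫ := by
  have hι := (h.contMDiff_val hk).mdifferentiable two_ne_zero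
  have hc1 : ∀ i, Differentiable ℝ (c i) := fun i ↦ (hc i).differentiable two_ne_zero
  have hgrad (y : feasibleSet c) (w : TangentSpace (𝓡 (n - m)) y) :
      inner ℝ (riemannianGradient (𝓡 (n - m)) (fun y : feasibleSet c ↦ f y) y) w =
        fderiv ℝ f y (inclusionDeriv y w) := by
    rw [inner_riemannianGradient]
    exact mvfderiv_comp_val (hf y) (hι y) w
  refine h.inner_cov_eq hk hcov
    (h.mdifferentiableAt_of_inner_eq hk (α := fun y : feasibleSet c ↦ fderiv ℝ f y) ?_ hgrad)
    (G := fun y ↦ gradLagrangian f c y ν) ?_ (fun y w ↦ ?_) ?_ ξ η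
  · exact (hf' x).mdifferentiableAt.comp x (hι x)
  · exact differentiableAt_gradLagrangian hf hc1 (hf' x) (fun i ↦
      ((hc i).fderiv_right (m := 1) le_rfl).differentiable one_ne_zero x) ν
  · rw [hgrad]
    refine (inner_gradLagrangian_of_mem_tangentSubspace (hf y) (fun i ↦ hc1 i y) ν ?_).symm
    rw [← h.range_inclusionDeriv hk hc1 y (hLICQ y y.2)]
    exact ⟨w, rfl⟩
  · exact h.inclusionDeriv_riemannianGradient hk hf hc1 x (hLICQ x x.2) hν

end IsEmbeddedRiemannianSubmanifold

end ConstrainedProblem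

end

theorem mainTheorem3 {n m : ℕ} (k : ℕ∞) (hk : 2 ≤ k)
    (f : EuclideanSpace ℝ (Fin n) → ℝ) (c : Fin m → EuclideanSpace ℝ (Fin n) → ℝ)
    (hf : Differentiable ℝ f) (hf' : Differentiable ℝ (fderiv ℝ f))
    (hc : ∀ i, ContDiff ℝ k (c i))
    (hLICQ : ∀ x ∈ feasibleSet c, LICQAt c x) :
    -- the multipliers exist and are unique
    (∀ x ∈ feasibleSet c, ∃! ν, IsMultiplier f c x ν) ∧
    -- `Ω` is an embedded Riemannian submanifold of dimension `n - m`
    (∃ (_ : ChartedSpace (EuclideanSpace ℝ (Fin (n - m))) (feasibleSet c))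
        (_ : IsManifold (𝓡 (n - m)) 2 (feasibleSet c))
        (_ : Bundle.RiemannianBundle (fun x : feasibleSet c ↦
          TangentSpace (𝓡 (n - m)) x)),
        IsEmbeddedRiemannianSubmanifold (EuclideanSpace ℝ (Fin (n - m))) k (feasibleSet c)) ∧
    -- for every choice of multipliers and this (that is, any such) structure:
    ∀ μ : EuclideanSpace ℝ (Fin n) → EuclideanSpace ℝ (Fin m),
      (∀ x ∈ feasibleSet c, IsMultiplier f c x (μ x)) →
    ∀ (_ : ChartedSpace (EuclideanSpace ℝ (Fin (n - m))) (feasibleSet c))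
      (_ : IsManifold (𝓡 (n - m)) 2 (feasibleSet c))
      (_ : Bundle.RiemannianBundle (fun x : feasibleSet c ↦
        TangentSpace (𝓡 (n - m)) x)),
      IsEmbeddedRiemannianSubmanifold (EuclideanSpace ℝ (Fin (n - m))) k (feasibleSet c) →
      -- the tangent space, seen in `ℝⁿ`, is the tangent subspace
      (∀ x : feasibleSet c,
        (inclusionDeriv (E := EuclideanSpace ℝ (Fin (n - m))) x).range = tangentSubspace c x) ∧
      -- the generalized gradient is the Riemannian gradient
      (∀ x : feasibleSet c,
        inclusionDeriv x
          (riemannianGradient (𝓡 (n - m))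
            (fun y : feasibleSet c ↦ f y) x) = generalizedGradient f c μ x) ∧
      -- the Riemannian connection exists, and the generalized Hessian is the Riemannian Hessian
      (∃ cov : CovariantDerivative (𝓡 (n - m))
          (EuclideanSpace ℝ (Fin (n - m)))
          (fun x : feasibleSet c ↦ TangentSpace (𝓡 (n - m)) x),
        IsLeviCivita cov) ∧
      ∀ cov : CovariantDerivative (𝓡 (n - m))
          (EuclideanSpace ℝ (Fin (n - m)))
          (fun x : feasibleSet c ↦ TangentSpace (𝓡 (n - m)) x),
        IsLeviCivita cov →
        ∀ (x : feasibleSet c)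
          (ξ η : TangentSpace (𝓡 (n - m)) x),
          riemannianHessian cov (fun y : feasibleSet c ↦ f y) x ξ η =
            ⟪generalizedHessian f c μ x
                (inclusionDeriv x ξ),
              inclusionDeriv x η⟫ := by
  have hk' : (2 : ℕ∞ω) ≤ k := WithTop.coe_le_coe.2 hk
  have hc1 : ∀ i, Differentiable ℝ (c i) := fun i ↦ (hc i).differentiable (two_pos.trans_le hk').ne'
  refine ⟨fun x hx ↦ existsUnique_isMultiplier (hf x) (fun i ↦ hc1 i x) (hLICQ x hx),
    exists_isEmbeddedRiemannianSubmanifold_feasibleSet hk hc hLICQ, ?_⟩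
  intro μ hμ _ _ _ h
  have hrange := fun x : feasibleSet c ↦ h.range_inclusionDeriv hk hc1 x (hLICQ x x.2)
  refine ⟨hrange, fun x ↦ h.inclusionDeriv_riemannianGradient hk hf hc1 x (hLICQ x x.2) (hμ x x.2),
    ⟨h.tangentialConnection hk, h.isLeviCivita_tangentialConnection hk⟩, fun cov hcov x ξ η ↦ ?_⟩
  have hP (v : TangentSpace (𝓡 (n - m)) x) :
      tangentProjection c x (inclusionDeriv x v) = inclusionDeriv x v :=
    Submodule.starProjection_eq_self_iff.2 (hrange x ▸ ⟨v, rfl⟩)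
  rw [h.riemannianHessian_eq hk hf hf' (fun i ↦ (hc i).of_le hk') hLICQ hcov x (hμ x x.2),
    generalizedHessian, ContinuousLinearMap.comp_apply, ContinuousLinearMap.comp_apply,
    ContinuousLinearMap.adjoint_inner_left, hP, hP]
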